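/- **Setting.** An infinite labeled line is a connected $2$-regular graph $G=(V,E)$ on a countably infinite vertex set together with an injective labeling $\ell:V\to\{1,2,3,\dots\}$. Distances are measured in $G$; $N^k(S)$ is the set of vertices at distance at most $k$ from $S$; $G^k$ joins distinct vertices at distance at most $k$; $G^k[U]$ is the subgraph of $G^k$ induced by $U$. Let $\log$ be the base-$2$ logarithm, $\log^*x=1$ for $x\le 1$ and $\log^*x=1+\log^*(\log x)$ for $x>1$, and $V_i=\{v:\log^*\ell(v)=i\}$ for $i\ge 1$. A set $S$ is a $U$-limited $(\alpha,\beta)$-ruling set of $G$ if $S\subseteq U$, any two distinct vertices of $S$ are at distance at least $\alpha$, and every vertex of $U$ is at distance at most $\beta$ from $S$. Let $R\ge 1$ be an integer. A *greedy step* on $(U,S)$ puts $b_v=\mathrm{dist}(v,S)$ and $C=\{v\in U: b_v\ge R\}$, and adds to $S$ all $v\in C$ such that every $u\in C\setminus\{v\}$ with $\mathrm{dist}(u,v)\le R-1$ satisfies $b_u<b_v$, or $b_u=b_v$ and $\ell(u)<\ell(v)$. *PathRulingSet* on a finite set $U$: let $d=\lceil\log R\rceil$ and $M_0=U$; for $i=1,\dots,d$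 let $M_i$ be a maximal independent set of $G^{R_i}[M_{i-1}]$, where $R_i=2^i-1$ for $i\le d-1$ and $R_d=R-1$; then perform $6$ greedy steps on $(U,M_d)$ and return the resulting set. *ES-ColPathRulingSet$(R)$* starts with $S=\emptyset$ and treats $V_1,V_2,\dots$ as follows. For $V_i$, compute a result $P_i$ of PathRulingSet on $V_i$; after all vertices of $V_1,\dots,V_{i-1}$ have terminated, let $S_{<i}$ be the current $S$, replace $S$ by $S_{<i}\cup(P_i\setminus N^{R-1}(S_{<i}))$, and perform $4$ greedy steps on $(V_i,S)$. Color the vertices of $S\setminus S_{<i}$ by a list coloring $\chi$ of $G^{9R-1}[S\setminus S_{<i}]$, where the list of $u$ is $[17]\setminus\{\chi(w):w\in S_{<i}\cap N^{9R-1}(u)\}$. Finally all vertices $v\in V_i$ terminate in a common round, and $v$ outputs whether $v\in S$, its color if so, and the labels and colors of the members of $S$ at distance less than $R$ from $v$. The maximal independent sets and list colorings are computed by deterministic subroutines of the LOCAL model (synchronous rounds, unbounded messages and local computation, each node initially knowing only its own label). **Lemma.** 1. There is a universal constant $\kappa$ such that, for suitable subroutines and waiting times, for every $R\ge1$, ES-ColPathRulingSet$(R)$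 is a deterministic LOCAL algorithm in which, on every infinite labeled line, every node $v$ terminates within $\kappa R\log^*\ell(v)$ rounds. 2. Consider any run of ES-ColPathRulingSet$(R)$ on an infinite labeled line, whatever maximal independent sets, list colorings and waiting times are used. For a round $T$ let $U_T$ be the set of nodes that have terminated up to round $T$, $S_T\subseteq U_T$ the set of those that output that they joined $S$, and $\chi_T:S_T\to[17]$ the colors that they output. Then, for every $T$, $S_T$ is a $U_T$-limited $(R,R-1)$-ruling set of $G$, and $\chi_T$ is a proper coloring of $G^{9R-1}[S_T]$. Moreover, every node $v$ that terminates in round $T$ outputs exactly the labels and colors under $\chi_T$ of the nodes $u\in S_T$ with $\mathrm{dist}(u,v)<R$. -/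

import Mathlib

open scoped ENat

universe u

/-! ### The iterated logarithm, with the convention `log* x ≥ 1` -/

theorem ceil_logb_two_lt {x : ℝ} (hx : 1 < x) : ⌈Real.logb 2 x⌉₊ < ⌈x⌉₊ := by
  have h1 : 1 < ⌈x⌉₊ := Nat.lt_ceil.mpr (by simpa using hx)
  have hle : x ≤ (⌈x⌉₊ : ℝ) := Nat.le_ceil x
  obtain ⟨m, hm⟩ : ∃ m, ⌈x⌉₊ = m + 1 := ⟨⌈x⌉₊ - 1, by omega⟩
  have hpow : (⌈x⌉₊ : ℝ) ≤ (2 : ℝ) ^ m := by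
    have : m + 1 ≤ 2 ^ m := Nat.lt_two_pow_self
    rw [hm]; exact_mod_cast this
  have hlog : Real.logb 2 x ≤ (m : ℝ) := by
    rw [Real.logb_le_iff_le_rpow (by norm_num) (by linarith), Real.rpow_natCast]
    exact hle.trans hpow
  have : ⌈Real.logb 2 x⌉₊ ≤ m := Nat.ceil_le.mpr hlog
  omega

/-- `log* x = 1` if `x ≤ 1`, and `log* x = 1 + log* (log₂ x)` otherwise. -/
noncomputable def logStar (x : ℝ) : ℕ :=
  if h : x ≤ 1 then 1 else 1 + logStar (Real.logb 2 x)
termination_by ⌈x⌉₊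
decreasing_by exact ceil_logb_two_lt (not_le.mp h)

/-! ### Graph notions -/

section Graphs

variable {V : Type*}

/-- An infinite line: a connected 2-regular graph on a countably infinite vertex set. -/
structure IsInfiniteLine (G : SimpleGraph V) [G.LocallyFinite] : Prop where
  countable : Countable V
  infinite : Infinite V
  connected : G.Connected
  regular : G.IsRegularOfDegree 2

/-- Unique labels in the positive integers. -/
structure IsLabeling (ℓ : V → ℕ) : Prop where
  pos : ∀ v, 1 ≤ ℓ v
  injective : Function.Injective ℓ

/-- The power graph `G ^ k`: distinct vertices at distance at most `k` in `G` are adjacent. -/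
def powerGraph (G : SimpleGraph V) (k : ℕ) : SimpleGraph V where
  Adj u v := u ≠ v ∧ G.edist u v ≤ k
  symm := ⟨fun u v h => ⟨h.1.symm, by rw [SimpleGraph.edist_comm]; exact h.2⟩⟩
  loopless := ⟨fun _ h => h.1 rfl⟩

/-- `N^k(S)`: the vertices at distance at most `k` from some vertex of `S`. -/
def neighborhood (G : SimpleGraph V) (k : ℕ) (S : Set V) : Set V :=
  {v | ∃ u ∈ S, G.edist v u ≤ k}

/-- `S` is a `U`-limited `(α, β)`-ruling set of `G`; distances are measured in `G`. -/
structure IsLimitedRulingSet (G : SimpleGraph V) (U S : Set V) (α β : ℕ) : Prop where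
  subset : S ⊆ U
  packing : ∀ u ∈ S, ∀ v ∈ S, u ≠ v → (α : ℕ∞) ≤ G.edist u v
  covering : ∀ u ∈ U, ∃ v ∈ S, G.edist u v ≤ β

/-- `S` is a maximal independent set (independent and dominating) of the induced graph `H[U]`. -/
structure IsMISOn (H : SimpleGraph V) (U S : Set V) : Prop where
  subset : S ⊆ U
  independent : ∀ u ∈ S, ∀ v ∈ S, ¬ H.Adj u v
  dominating : ∀ u ∈ U, u ∉ S → ∃ v ∈ S, H.Adj u v

/-- The restriction of `χ` to `U` is a list coloring of the induced graph `H[U]` for the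
lists `ψ`. -/
structure IsListColoringOn {C : Type*} (H : SimpleGraph V) (U : Set V) (ψ : V → Set C)
    (χ : V → C) : Prop where
  mem_list : ∀ u ∈ U, χ u ∈ ψ u
  proper : ∀ u ∈ U, ∀ v ∈ U, H.Adj u v → χ u ≠ χ v

/-- The distance `b_v` from `v` to the set `S` (`⊤` if `S` is empty). -/
noncomputable def distToSet (G : SimpleGraph V) (S : Set V) (v : V) : ℕ∞ :=
  ⨅ u ∈ S, G.edist v u

/-- `U_cand`: the vertices of `U` at distance at least `R` from `S`. -/
def candidates (G : SimpleGraph V) (U : Set V) (R : ℕ) (S : Set V) : Set V :=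
  {v ∈ U | (R : ℕ∞) ≤ distToSet G S v}

/-- One iteration of the greedy extension: all candidates join `S` that beat every other
candidate within distance `R - 1`, in the lexicographic order of distance to `S` and label. -/
def greedyStep (G : SimpleGraph V) (ℓ : V → ℕ) (U : Set V) (R : ℕ) (S : Set V) : Set V :=
  S ∪ {v ∈ candidates G U R S | ∀ u ∈ candidates G U R S, u ≠ v →
    G.edist v u ≤ ((R - 1 : ℕ) : ℕ∞) →
      distToSet G S u < distToSet G S v ∨
        (distToSet G S u = distToSet G S v ∧ ℓ u < ℓ v)}

/-- `V_i`: the vertices whose label has iterated logarithm `i`. -/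
def labelClass (ℓ : V → ℕ) (i : ℕ) : Set V := {v | logStar (ℓ v) = i}

/-! ### The procedure `PathRulingSet` -/

/-- The radius `R_i` used in iteration `i`, where `⌈log₂ R⌉` is the number of iterations. -/
def misRadius (R i : ℕ) : ℕ := if i + 1 ≤ Nat.clog 2 R then 2 ^ i - 1 else R - 1

/-- `S_out` is a possible result of `PathRulingSet` on the set `U` with distance `R`: for
`i = 1, …, d` with `d = ⌈log₂ R⌉`, `M i` is some maximal independent set of
`G^{R_i}[M (i - 1)]`, where `M 0 = U`, and `S_out` is obtained from `M d` by six greedy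
iterations. -/
def IsPathRulingSetResult (G : SimpleGraph V) (ℓ : V → ℕ) (U : Set V) (R : ℕ)
    (Sout : Set V) : Prop :=
  ∃ M : ℕ → Set V, M 0 = U ∧
    (∀ i, 1 ≤ i → i ≤ Nat.clog 2 R →
      IsMISOn (powerGraph G (misRadius R i)) (M (i - 1)) (M i)) ∧
    Sout = (greedyStep G ℓ U R)^[6] (M (Nat.clog 2 R))

/-! ### The procedure `ES-ColPathRulingSet` -/

/-- The sets and colors computed by `ES-ColPathRulingSet(R)`: `S i` is the value of the variable
`S` after the vertices of `V_1, …, V_i` have been treated, and `χ` records the color that each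
vertex receives when it joins `S` (its values at other vertices are irrelevant). -/
structure IsESColTrace (G : SimpleGraph V) (ℓ : V → ℕ) (R : ℕ) (S : ℕ → Set V)
    (χ : V → Fin 17) : Prop where
  start : S 0 = ∅
  extend : ∀ i, 1 ≤ i → ∃ P : Set V,
    IsPathRulingSetResult G ℓ (labelClass ℓ i) R P ∧
    S i = (greedyStep G ℓ (labelClass ℓ i) R)^[4]
      (S (i - 1) ∪ (P \ neighborhood G (R - 1) (S (i - 1))))
  color : ∀ i, 1 ≤ i →
    IsListColoringOn (powerGraph G (9 * R - 1)) (S i \ S (i - 1))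
      (fun u => {c | ∀ w ∈ S (i - 1) ∩ neighborhood G (9 * R - 1) {u}, c ≠ χ w}) χ

/-- What a vertex outputs: `color = some c` says that it is in the ruling set, with color `c`,
and `color = none` that it is not; `nearby` is the set of labels, with colors, of the known
members of the ruling set near the vertex. -/
structure NodeOutput where
  color : Option (Fin 17)
  nearby : Set (ℕ × Fin 17)

open Classical in
/-- The output that `v` commits to when the ruling set is `S` with coloring `χ`. -/
noncomputable def committedOutput (G : SimpleGraph V) (ℓ : V → ℕ) (R : ℕ) (S : Set V)
    (χ : V → Fin 17) (v : V) : NodeOutput where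
  color := if v ∈ S then some (χ v) else none
  nearby := {p | ∃ u ∈ S, G.edist v u ≤ ((R - 1 : ℕ) : ℕ∞) ∧ p = (ℓ u, χ u)}

/-- `out t v` is what `v` has output up to round `t` (`none` before `v` terminates).  This is a
run of `ES-ColPathRulingSet(R)` with schedule `T` if all vertices of `V_i` commit in round `T i`,
after the vertices of `V_1, …, V_{i-1}` have done so, to the output that the procedure
prescribes. -/
def IsESColRun (G : SimpleGraph V) (ℓ : V → ℕ) (R : ℕ) (T : ℕ → ℕ)
    (out : ℕ → V → Option NodeOutput) : Prop :=
  StrictMono T ∧ ∃ (S : ℕ → Set V) (χ : V → Fin 17), IsESColTrace G ℓ R S χ ∧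
    ∀ t v, out t v =
      if T (logStar (ℓ v)) ≤ t then some (committedOutput G ℓ R (S (logStar (ℓ v))) χ v)
      else none

/-! ### Reading off a run -/

/-- `U_T`: the vertices that have terminated up to round `T`. -/
def terminatedSet (out : ℕ → V → Option NodeOutput) (T : ℕ) : Set V :=
  {v | (out T v).isSome}

/-- `χ_T`, as a partial function: the color output by `v` up to round `T`, if any. -/
def colorAt (out : ℕ → V → Option NodeOutput) (T : ℕ) (v : V) : Option (Fin 17) :=
  (out T v).bind NodeOutput.color

/-- `S_T`: the vertices that have terminated up to round `T` and joined the ruling set. -/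
def joinedSet (out : ℕ → V → Option NodeOutput) (T : ℕ) : Set V :=
  {v | (colorAt out T v).isSome}

/-- `T` is the round in which `v` terminates. -/
def TerminatesInRound (out : ℕ → V → Option NodeOutput) (v : V) (T : ℕ) : Prop :=
  v ∈ terminatedSet out T ∧ ∀ t < T, v ∉ terminatedSet out t

end Graphs

/-! ### The LOCAL model with early stopping -/

/-- A deterministic algorithm of the synchronous LOCAL model.  A node knows its own label at the
start; in each round it sends a message to all its neighbors, receives theirs, and updates its
state.  Messages and local computation are unbounded.  Once a node has produced an output, it is
committed to it, but it may still forward messages.  Sending the same message to all neighbors and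
not knowing from which port a message came only restricts the algorithm. -/
structure LocalAlgorithm (Out : Type) where
  State : Type
  Msg : Type
  init : ℕ → State
  send : State → Msg
  step : State → Multiset Msg → State
  output : State → Option Out
  commit : ∀ s m o, output s = some o → output (step s m) = some o

namespace LocalAlgorithm

variable {V : Type*} {Out : Type}

/-- The state of each node after `t` rounds. -/
def state (A : LocalAlgorithm Out) (G : SimpleGraph V) [G.LocallyFinite] (ℓ : V → ℕ) :
    ℕ → V → A.State
  | 0, v => A.init (ℓ v)
  | t + 1, v => A.step (A.state G ℓ t v)
      ((G.neighborFinset v).val.map fun u => A.send (A.state G ℓ t u))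

/-- The output, if any, of each node after `t` rounds. -/
def run (A : LocalAlgorithm Out) (G : SimpleGraph V) [G.LocallyFinite] (ℓ : V → ℕ)
    (t : ℕ) (v : V) : Option Out :=
  A.output (A.state G ℓ t v)

end LocalAlgorithm

/-!
Every component of a line is isometric to a set of integers. Hence the points of an
`α`-separated set within distance `k < (q + 1) α` of one of them number at most `2 q`: on each
side they are told apart by the quotients of their distances by `α`. So the power graphs on which
independent sets and colorings are computed have degree at most `2` and `16`, respectively.

Before the greedy steps on `U`, every vertex of `U` is at distance less than `3 R` from the
current set. As long as a vertex `v` of `U` is not covered, each greedy step adds a point to the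
gap of the current set that contains `v`, because the lexicographically largest candidate of a gap
only competes with candidates of the same gap. Five such points would include three whose nearest
old rulers lie on the same side; they are `R` apart from each other and from the rulers, so one of
them would be at distance at least `3 R` from its ruler. Thus four steps suffice. Each `V_i` is
finite, later classes only add vertices of their own, and so the outputs in any round are those of
a prefix of the computation.

For the running time, identify vertices with their labels. On `V_i` the labels are a coloring with
at most `tower (i - 1) + 1` colors; repeatedly replacing a color by the set of the bits that
distinguish it from the neighboring colors leaves a constant number of colors after `O(i)` rounds,
and treating the color classes one after the other then gives maximal independent sets and list
colorings. The radii of the `O(log R)` independent sets form a geometric sum, and all other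
distances involved are `O(R)`, so the treatment of `V_i` extends the radius on which the outputs
depend by `O(R)`, apart from `O(R i)` rounds of color reduction that do not depend on earlier
classes. A vertex of `V_i` therefore only has to collect its neighborhood of radius `O(R i)`.
-/

section Distances

variable {V : Type*} {G : SimpleGraph V}

/-- Distinct points of `S` are at distance at least `α`. -/
def IsPacking (G : SimpleGraph V) (α : ℕ) (S : Set V) : Prop :=
  ∀ u ∈ S, ∀ v ∈ S, u ≠ v → (α : ℕ∞) ≤ G.edist u v

/-- Every point of `U` is at distance at most `β` from `S`. -/
def IsCovering (G : SimpleGraph V) (U S : Set V) (β : ℕ) : Prop :=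
  ∀ u ∈ U, ∃ v ∈ S, G.edist u v ≤ β

theorem eq_of_forall_le_natCast_iff {m n : ℕ∞} (h : ∀ k : ℕ, m ≤ k ↔ n ≤ k) : m = n :=
  eq_of_forall_ge_iff fun k => by cases k <;> simp [h]

theorem reachable_of_edist_le {u v : V} {n : ℕ} (h : G.edist u v ≤ n) : G.Reachable u v :=
  SimpleGraph.edist_ne_top_iff_reachable.mp (ne_top_of_le_ne_top (ENat.natCast_ne_top n) h)

theorem edist_le_natCast_iff {u v : V} {n : ℕ} :
    G.edist u v ≤ n ↔ ∃ p : G.Walk u v, p.length ≤ n := by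
  constructor
  · intro h
    obtain ⟨p, hp⟩ := (reachable_of_edist_le h).exists_walk_length_eq_edist
    exact ⟨p, by rw [← hp] at h; exact_mod_cast h⟩
  · rintro ⟨p, hp⟩
    exact p.edist_le.trans (by exact_mod_cast hp)

theorem edist_le_succ_iff {u w : V} {n : ℕ} :
    G.edist u w ≤ (n + 1 : ℕ) ↔ u = w ∨ ∃ y, G.Adj u y ∧ G.edist y w ≤ n := by
  simp only [edist_le_natCast_iff]
  constructor
  · rintro ⟨p, hp⟩
    cases p with
    | nil => exact Or.inl rfl
    | cons h q => exact Or.inr ⟨_, h, q, by simpa using hp⟩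
  · rintro (rfl | ⟨y, hy, p, hp⟩)
    · exact ⟨.nil, by simp⟩
    · exact ⟨.cons hy p, by simpa using hp⟩

theorem edist_le_succ_iff' {u w : V} {n : ℕ} :
    G.edist u w ≤ (n + 1 : ℕ) ↔ u = w ∨ ∃ y, G.edist u y ≤ n ∧ G.Adj y w := by
  rw [SimpleGraph.edist_comm, edist_le_succ_iff]
  simp only [SimpleGraph.edist_comm, SimpleGraph.adj_comm, and_comm, eq_comm]

theorem edist_le_add {a b c : V} {m n : ℕ} (h : G.edist a b ≤ m) (h' : G.edist b c ≤ n) :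
    G.edist a c ≤ (m + n : ℕ) :=
  SimpleGraph.edist_triangle.trans (by push_cast; exact add_le_add h h')

theorem edist_lt_iff_le_pred {a b : V} {R : ℕ} (hR : 1 ≤ R) :
    G.edist a b < R ↔ G.edist a b ≤ ((R - 1 : ℕ) : ℕ∞) := by
  have h : ((R - 1 : ℕ) : ℕ∞) + 1 = R := by exact_mod_cast Nat.sub_add_cancel hR
  rw [← h, ENat.lt_add_one_iff (ENat.natCast_ne_top _)]

theorem isPacking_one (S : Set V) : IsPacking G 1 S := fun _ _ _ _ huv => by
  simpa [Order.one_le_iff_pos] using SimpleGraph.edist_pos_of_ne huv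

theorem IsCovering.mono {U S S' : Set V} {β β' : ℕ} (h : IsCovering G U S β) (hS : S ⊆ S')
    (hβ : β ≤ β') : IsCovering G U S' β' := fun u hu =>
  let ⟨v, hv, hd⟩ := h u hu
  ⟨v, hS hv, hd.trans (by exact_mod_cast hβ)⟩

theorem IsCovering.trans {U S S' : Set V} {β β' : ℕ} (h : IsCovering G U S β)
    (h' : IsCovering G S S' β') : IsCovering G U S' (β + β') := fun u hu =>
  let ⟨v, hv, hd⟩ := h u hu
  let ⟨w, hw, hd'⟩ := h' v hv
  ⟨w, hw, edist_le_add hd hd'⟩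

theorem IsCovering.refl (U : Set V) : IsCovering G U U 0 := fun u hu => ⟨u, hu, by simp⟩

end Distances

section LineMetric

variable {V : Type*} {G : SimpleGraph V}

/-- `pos` is an isometry from the component of `v` onto a set of integers; its values elsewhere
are irrelevant. -/
def IsCoordinate (G : SimpleGraph V) (v : V) (pos : V → ℤ) : Prop :=
  ∀ x y, G.Reachable v x → G.Reachable v y → G.edist x y = ((pos x - pos y).natAbs : ℕ)

/-- Every component of `G` is isometric to a set of integers. Unlike being a line, this is
inherited by the image of `G` on the labels, where the numbers that are not labels are isolated. -/
def LineMetric (G : SimpleGraph V) : Prop :=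
  ∀ v, ∃ pos : V → ℤ, IsCoordinate G v pos

namespace IsCoordinate

variable {v x y : V} {pos : V → ℤ} {n : ℕ}

theorem edist_le_iff (h : IsCoordinate G v pos) (hx : G.Reachable v x) (hy : G.Reachable v y) :
    G.edist x y ≤ n ↔ (pos x - pos y).natAbs ≤ n := by
  rw [h x y hx hy, Nat.cast_le]

theorem le_edist_iff (h : IsCoordinate G v pos) (hx : G.Reachable v x) (hy : G.Reachable v y) :
    n ≤ G.edist x y ↔ n ≤ (pos x - pos y).natAbs := by
  rw [h x y hx hy, Nat.cast_le]

end IsCoordinate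

/-- Distances from `v` are at least `α` and less than `(q + 1) * α`, so a neighbour is determined
by its side of `v` and by the quotient of its distance by `α`, one of `1, …, q`. -/
theorem LineMetric.encard_powerGraph_neighbors_le (hG : LineMetric G) {A : Set V} {α k q : ℕ}
    (hα : 1 ≤ α) (hA : IsPacking G α A) (hk : k < (q + 1) * α) {v : V} (hv : v ∈ A) :
    {y ∈ A | (powerGraph G k).Adj v y}.encard ≤ (2 * q : ℕ) := by
  obtain ⟨pos, hpos⟩ := hG v
  set N := {y ∈ A | (powerGraph G k).Adj v y}
  have hreach (y) (hy : y ∈ N) : G.Reachable v y := reachable_of_edist_le hy.2.2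
  let side_quotient (y : V) : Bool × ℕ := (decide (pos y < pos v), (pos v - pos y).natAbs / α)
  let T : Finset (Bool × ℕ) := Finset.univ ×ˢ Finset.Icc 1 q
  have hmaps : Set.MapsTo side_quotient N T := by
    intro y hy
    have hle := (hpos.edist_le_iff .rfl (hreach y hy)).mp hy.2.2
    have hge := (hpos.le_edist_iff .rfl (hreach y hy)).mp (hA v hv y hy.1 hy.2.1)
    have hlt := (Nat.div_lt_iff_lt_mul (by omega)).mpr (hle.trans_lt hk)
    exact Finset.mem_product.mpr ⟨Finset.mem_univ _,
      Finset.mem_Icc.mpr ⟨(Nat.one_le_div_iff hα).mpr hge, Nat.lt_succ_iff.mp hlt⟩⟩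
  have hinj : Set.InjOn side_quotient N := by
    intro y hy z hz hyz
    by_contra hne
    have hsep := (hpos.le_edist_iff (hreach y hy) (hreach z hz)).mp (hA y hy.1 z hz.1 hne)
    obtain ⟨hside, hquot⟩ := by simpa [side_quotient] using hyz
    have hy_mod := Nat.div_add_mod (pos v - pos y).natAbs α
    have hz_mod := Nat.div_add_mod (pos v - pos z).natAbs α
    have hy_lt := Nat.mod_lt (pos v - pos y).natAbs hα
    have hz_lt := Nat.mod_lt (pos v - pos z).natAbs hα
    rw [hquot] at hy_mod
    omega
  calc N.encard ≤ (T : Set (Bool × ℕ)).encard := Set.encard_le_encard_of_injOn hmaps hinj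
    _ = (2 * q : ℕ) := by rw [Set.encard_coe_eq_coe_finsetCard]; simp [T]

end LineMetric

section InfiniteLine

variable {V : Type*} {G : SimpleGraph V}

theorem eq_univ_of_adj_closed (hG : G.Preconnected) {s : Set V} (hs : s.Nonempty)
    (h : ∀ x ∈ s, ∀ y, G.Adj x y → y ∈ s) : s = Set.univ := by
  obtain ⟨x, hx⟩ := hs
  refine Set.eq_univ_of_forall fun y => by_contra fun hy => ?_
  obtain ⟨p⟩ := hG x y
  obtain ⟨d, -, hfst, hsnd⟩ := p.exists_boundary_dart s hx hy
  exact hsnd (h _ hfst _ d.adj)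

theorem exists_other_neighbor [G.LocallyFinite] (hG : G.IsRegularOfDegree 2) {v u : V}
    (h : G.Adj v u) : ∃ w, G.Adj v w ∧ w ≠ u ∧ ∀ x, G.Adj v x → x = u ∨ x = w := by
  classical
  obtain ⟨a, b, hab, he⟩ := Finset.card_eq_two.mp (hG v)
  have hadj (x) : G.Adj v x ↔ x = a ∨ x = b := by
    rw [← SimpleGraph.mem_neighborFinset, he]; simp
  rcases (hadj u).mp h with rfl | rfl
  · exact ⟨b, (hadj b).mpr (Or.inr rfl), hab.symm, fun x hx => (hadj x).mp hx⟩
  · exact ⟨a, (hadj a).mpr (Or.inl rfl), hab, fun x hx => ((hadj x).mp hx).symm⟩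

/-- `p` walks along `G` without ever turning back, and it passes through all neighbours of the
vertices that it visits. -/
def IsTraversal (G : SimpleGraph V) (p : ℤ → V) : Prop :=
  ∀ n, p (n - 1) ≠ p (n + 1) ∧ ∀ x, G.Adj (p n) x ↔ x = p (n - 1) ∨ x = p (n + 1)

/-- "Move on to the next edge" is a permutation of the darts, the composition of two involutions:
reversing a dart, and exchanging the two darts that leave a vertex. -/
theorem exists_isTraversal [G.LocallyFinite] (hG : G.IsRegularOfDegree 2) (v₀ : V) :
    ∃ p : ℤ → V, IsTraversal G p := by
  have hexists := fun v u (h : G.Adj v u) => exists_other_neighbor hG h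
  choose! other hadj hne hall using hexists
  have hother (v u) (h : G.Adj v u) : other v (other v u) = u :=
    (hall v u h _ (hadj v _ (hadj v u h))).resolve_right (hne v _ (hadj v u h))
  let exchange (d : G.Dart) : G.Dart := ⟨(d.fst, other d.fst d.snd), hadj _ _ d.adj⟩
  have hexchange : Function.Involutive exchange := fun d =>
    SimpleGraph.Dart.ext _ _ (Prod.ext rfl (hother _ _ d.adj))
  let next : Equiv.Perm G.Dart :=
    SimpleGraph.Dart.symm_involutive.toPerm.trans hexchange.toPerm
  obtain ⟨u₀, hu₀⟩ : ∃ u, G.Adj v₀ u := by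
    have hpos : 0 < G.degree v₀ := by rw [hG v₀]; norm_num
    exact (G.degree_pos_iff_exists_adj v₀).mp hpos
  let d (n : ℤ) : G.Dart := (next ^ n) ⟨(v₀, u₀), hu₀⟩
  have hd (n) : d (n + 1) = next (d n) := by
    simp only [d, add_comm n 1, zpow_add, zpow_one, Equiv.Perm.mul_apply]
  have hsnd (n) : (d n).snd = (d (n + 1)).fst := by rw [hd]; rfl
  refine ⟨fun n => (d n).fst, fun n => ?_⟩
  have hstep : d n = next (d (n - 1)) := by rw [← hd, sub_add_cancel]
  have hback : G.Adj (d n).fst (d (n - 1)).fst := by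
    have h := (d (n - 1)).adj.symm
    rwa [hsnd, sub_add_cancel] at h
  have hforth : other (d n).fst (d (n - 1)).fst = (d (n + 1)).fst := by
    rw [← hsnd, hstep]; rfl
  beta_reduce
  rw [← hforth]
  refine ⟨(hne _ _ hback).symm, fun x => ⟨hall _ _ hback x, ?_⟩⟩
  rintro (rfl | rfl)
  exacts [hback, hadj _ _ hback]

theorem exists_minimal_return {p : ℤ → V} (hp : ¬ Function.Injective p) :
    ∃ k : ℕ, 0 < k ∧ (∃ m, p (m + k) = p m) ∧ ∀ j : ℕ, 0 < j → j < k → ∀ n, p (n + j) ≠ p n := by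
  classical
  have hreturn : ∃ k : ℕ, 0 < k ∧ ∃ m, p (m + k) = p m := by
    obtain ⟨m, n, hmn, hne⟩ : ∃ m n, p m = p n ∧ m ≠ n := by
      simpa [Function.Injective] using hp
    rcases lt_or_gt_of_ne hne with h | h
    · exact ⟨(n - m).toNat, by omega, m, by rw [hmn]; congr 1; omega⟩
    · exact ⟨(m - n).toNat, by omega, n, by rw [← hmn]; congr 1; omega⟩
  obtain ⟨hk, hm⟩ := Nat.find_spec hreturn
  exact ⟨_, hk, hm, fun j hj hlt n h => Nat.find_min hreturn hlt ⟨hj, n, h⟩⟩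

namespace IsTraversal

variable {p : ℤ → V}

theorem surjective (hp : IsTraversal G p) (hG : G.Preconnected) : Function.Surjective p := by
  refine Set.range_eq_univ.mp (eq_univ_of_adj_closed hG (Set.range_nonempty p) ?_)
  rintro _ ⟨n, rfl⟩ y h
  rcases ((hp n).2 y).mp h with rfl | rfl <;> exact ⟨_, rfl⟩

/-- If the traversal closes up for the first time after `k` steps, then its vertices in between
are closed under adjacency, so `G` is finite. -/
theorem injective (hp : IsTraversal G p) (hG : G.Preconnected) [Infinite V] :
    Function.Injective p := by
  by_contra hinj
  obtain ⟨k, hk, ⟨m, hm⟩, hmin⟩ := exists_minimal_return hinj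
  have hk1 : k ≠ 1 := fun h => G.irrefl (((hp m).2 (p m)).mpr (Or.inr (by rw [← hm, h]; rfl)))
  have hk2 : k ≠ 2 := fun h => (hp (m + 1)).1 (by
    rw [h] at hm; convert hm.symm using 2 <;> push_cast <;> ring)
  have hlast : p (m + k - 1) = p (m - 1) := by
    have hadj : G.Adj (p m) (p (m + k - 1)) := by
      rw [← hm]; exact ((hp (m + k)).2 _).mpr (Or.inl rfl)
    refine (((hp m).2 _).mp hadj).resolve_right fun h => ?_
    refine hmin (k - 2) (by omega) (by omega) (m + 1) ?_
    rw [← h]; congr 1; omega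
  have huniv : p '' Set.Ico m (m + k) = Set.univ := by
    refine eq_univ_of_adj_closed hG ⟨p m, m, by simp [hk], rfl⟩ ?_
    rintro _ ⟨n, hn, rfl⟩ y h
    rw [Set.mem_Ico] at hn
    rcases ((hp n).2 y).mp h with rfl | rfl
    · by_cases hnm : n = m
      · exact ⟨m + k - 1, Set.mem_Ico.mpr (by omega), by rw [hlast, hnm]⟩
      · exact ⟨n - 1, Set.mem_Ico.mpr (by omega), rfl⟩
    · by_cases hnk : n + 1 = m + k
      · exact ⟨m, Set.mem_Ico.mpr (by omega), by rw [hnk, hm]⟩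
      · exact ⟨n + 1, Set.mem_Ico.mpr (by omega), rfl⟩
  exact Set.infinite_univ (huniv ▸ (Set.finite_Ico m (m + k)).image p)

theorem edist_le_iff (hp : IsTraversal G p) (hinj : Function.Injective p) {k : ℕ} {m n : ℤ} :
    G.edist (p m) (p n) ≤ k ↔ (m - n).natAbs ≤ k := by
  induction k generalizing m with
  | zero => simp [hinj.eq_iff, sub_eq_zero]
  | succ k ih =>
    simp only [edist_le_succ_iff, (hp m).2, hinj.eq_iff, or_and_right, exists_or, exists_eq_left,
      ih]
    omega

end IsTraversal

theorem IsInfiniteLine.lineMetric [G.LocallyFinite] (hG : IsInfiniteLine G) : LineMetric G := by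
  intro v
  have := hG.infinite
  obtain ⟨p, hp⟩ := exists_isTraversal hG.regular v
  have hinj := hp.injective hG.connected.preconnected
  obtain ⟨pos, hpos⟩ := (hp.surjective hG.connected.preconnected).hasRightInverse
  refine ⟨pos, fun x y _ _ => eq_of_forall_le_natCast_iff fun k => ?_⟩
  rw [← hp.edist_le_iff hinj |>.trans Nat.cast_le.symm, hpos x, hpos y]

end InfiniteLine

section IteratedLog

theorem one_le_logStar (x : ℝ) : 1 ≤ logStar x := by
  rw [logStar]; split_ifs <;> omega

/-- The tower function `1, 2, 4, 16, …`, the inverse of the iterated logarithm. -/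
def tower : ℕ → ℕ
  | 0 => 1
  | n + 1 => 2 ^ tower n

theorem one_le_tower : ∀ n, 1 ≤ tower n
  | 0 => le_rfl
  | _ + 1 => Nat.one_le_two_pow

theorem le_tower_of_logStar_le {i : ℕ} {x : ℝ} (h : logStar x ≤ i + 1) : x ≤ tower i := by
  induction i generalizing x with
  | zero =>
    rw [logStar] at h
    split_ifs at h with hx
    · simpa [tower] using hx
    · have := one_le_logStar (Real.logb 2 x)
      omega
  | succ i ih =>
    rw [logStar] at h
    split_ifs at h with hx
    · exact hx.trans (by exact_mod_cast one_le_tower _)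
    · have hlog := ih (x := Real.logb 2 x) (by omega)
      rw [Real.logb_le_iff_le_rpow (by norm_num) (by linarith), Real.rpow_natCast] at hlog
      simpa [tower] using hlog

theorem finite_labelClass {V : Type*} {ℓ : V → ℕ} (hℓ : Function.Injective ℓ) (i : ℕ) :
    (labelClass ℓ i).Finite := by
  refine Set.Finite.of_finite_image (f := ℓ) ((Set.finite_Iic (tower i)).subset ?_) hℓ.injOn
  rintro _ ⟨v, hv, rfl⟩
  have hv : logStar (ℓ v : ℝ) = i := hv
  exact_mod_cast le_tower_of_logStar_le (i := i) (x := ℓ v) (by omega)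

end IteratedLog

section Greedy

variable {V : Type*} {G : SimpleGraph V} {ℓ : V → ℕ} {U S : Set V} {R : ℕ}

theorem le_distToSet_iff {v : V} {n : ℕ∞} : n ≤ distToSet G S v ↔ ∀ s ∈ S, n ≤ G.edist v s := by
  simp [distToSet]

theorem distToSet_le_iff {v : V} {n : ℕ} : distToSet G S v ≤ n ↔ ∃ s ∈ S, G.edist v s ≤ n := by
  rw [← not_iff_not, not_le, ← ENat.add_one_le_iff (ENat.natCast_ne_top n), le_distToSet_iff]
  simp only [ENat.add_one_le_iff (ENat.natCast_ne_top n), not_exists, not_and, not_le]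

theorem mem_candidates_iff {v : V} :
    v ∈ candidates G U R S ↔ v ∈ U ∧ ∀ s ∈ S, (R : ℕ∞) ≤ G.edist v s :=
  and_congr_right' le_distToSet_iff

theorem subset_greedyStep : S ⊆ greedyStep G ℓ U R S := Set.subset_union_left

theorem greedyStep_subset : greedyStep G ℓ U R S ⊆ S ∪ U :=
  Set.union_subset_union_right S fun _ hv => hv.1.1

theorem greedyStep_iterate_mono {m n : ℕ} (h : m ≤ n) :
    (greedyStep G ℓ U R)^[m] S ⊆ (greedyStep G ℓ U R)^[n] S :=
  monotone_nat_of_le_succ (f := fun n => (greedyStep G ℓ U R)^[n] S)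
    (fun n => by rw [Function.iterate_succ_apply']; exact subset_greedyStep) h

theorem subset_greedyStep_iterate (n : ℕ) : S ⊆ (greedyStep G ℓ U R)^[n] S :=
  greedyStep_iterate_mono n.zero_le

theorem greedyStep_iterate_subset (n : ℕ) : (greedyStep G ℓ U R)^[n] S ⊆ S ∪ U := by
  induction n with
  | zero => exact Set.subset_union_left
  | succ n ih =>
    rw [Function.iterate_succ_apply']
    exact greedyStep_subset.trans (Set.union_subset ih Set.subset_union_right)

theorem isPacking_greedyStep (hR : 1 ≤ R) (hS : IsPacking G R S) :
    IsPacking G R (greedyStep G ℓ U R S) := by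
  rintro u (hu | hu) v (hv | hv) huv
  · exact hS u hu v hv huv
  · rw [SimpleGraph.edist_comm]; exact (mem_candidates_iff.mp hv.1).2 u hu
  · exact (mem_candidates_iff.mp hu.1).2 v hv
  · by_contra hlt
    rw [not_le, edist_lt_iff_le_pred hR] at hlt
    rcases hu.2 v hv.1 huv.symm hlt with h₁ | ⟨h₁, h₁'⟩ <;>
      rcases hv.2 u hu.1 huv (by rwa [SimpleGraph.edist_comm]) with h₂ | ⟨h₂, h₂'⟩
    · exact lt_asymm h₁ h₂
    · exact h₁.ne h₂.symm
    · exact h₂.ne h₁.symm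
    · exact lt_asymm h₁' h₂'

theorem isPacking_greedyStep_iterate (hR : 1 ≤ R) (hS : IsPacking G R S) (n : ℕ) :
    IsPacking G R ((greedyStep G ℓ U R)^[n] S) := by
  induction n with
  | zero => exact hS
  | succ n ih => rw [Function.iterate_succ_apply']; exact isPacking_greedyStep hR ih

/-- `x` lies in the component of `v`, and on the same side of each point of `S₀` as `v`, with
respect to the coordinate `pos`. -/
def SameGap (G : SimpleGraph V) (pos : V → ℤ) (S₀ : Set V) (v x : V) : Prop :=
  G.Reachable v x ∧ ∀ s ∈ S₀, G.Reachable v s →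
    (pos s < pos v ∧ pos s < pos x) ∨ (pos v < pos s ∧ pos x < pos s)

theorem sameGap_self {S₀ : Set V} {v : V} {pos : V → ℤ} (hpos : IsCoordinate G v pos)
    (hR : 1 ≤ R) (hS₀ : S₀ ⊆ S) (hv : v ∈ candidates G U R S) : SameGap G pos S₀ v v := by
  refine ⟨.rfl, fun s hs hvs => ?_⟩
  have hfar := (hpos.le_edist_iff .rfl hvs).mp ((mem_candidates_iff.mp hv).2 s (hS₀ hs))
  omega

/-- A point of `S₀` between `x` and the candidate `y` would be at distance at least `R` from `y`. -/
theorem SameGap.of_edist_le {S₀ : Set V} {v x y : V} {pos : V → ℤ} (h : SameGap G pos S₀ v x)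
    (hpos : IsCoordinate G v pos) (hR : 1 ≤ R) (hS₀ : S₀ ⊆ S) (hy : y ∈ candidates G U R S)
    (hxy : G.edist x y ≤ ((R - 1 : ℕ) : ℕ∞)) :
    SameGap G pos S₀ v y := by
  have hvy := h.1.trans (reachable_of_edist_le hxy)
  refine ⟨hvy, fun s hs hvs => ?_⟩
  have hys := (hpos.le_edist_iff hvy hvs).mp ((mem_candidates_iff.mp hy).2 s (hS₀ hs))
  have hclose := (hpos.edist_le_iff h.1 hvy).mp hxy
  have hside := h.2 s hs hvs
  omega

/-- The lexicographically largest candidate of a gap joins: its competitors lie in the same gap. -/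
theorem exists_mem_greedyStep_of_sameGap (hR : 1 ≤ R) (hℓ : Function.Injective ℓ) (hU : U.Finite)
    {S₀ : Set V} {v : V} {pos : V → ℤ} (hpos : IsCoordinate G v pos) (hS₀ : S₀ ⊆ S)
    (hv : v ∈ candidates G U R S) :
    ∃ x ∈ greedyStep G ℓ U R S, x ∈ candidates G U R S ∧ SameGap G pos S₀ v x := by
  set C : Set V := {x ∈ candidates G U R S | SameGap G pos S₀ v x}
  have hC : C.Finite := hU.subset fun x hx => hx.1.1
  obtain ⟨x, ⟨hx, hgap⟩, hmax⟩ := Set.exists_max_image C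
    (fun x => toLex (distToSet G S x, ℓ x)) hC ⟨v, hv, sameGap_self hpos hR hS₀ hv⟩
  refine ⟨x, Or.inr ⟨hx, fun u hu hux hxu => ?_⟩, hx, hgap⟩
  rcases Prod.Lex.toLex_le_toLex.mp (hmax u ⟨hu, hgap.of_edist_le hpos hR hS₀ hu hxu⟩) with
    h | ⟨h, h'⟩
  · exact Or.inl h
  · exact Or.inr ⟨h, h'.lt_of_ne (hℓ.ne hux)⟩

/-- Among five points `x k` of a gap, three have their nearby ruler `z k` on the same side. The
three are separated, so the farthest of them is at distance at least `3 * R` from all rulers on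
that side. -/
theorem not_five_separated_in_gap {c : ℤ} {x z : Fin 5 → ℤ}
    (hsep : ∀ j k, j ≠ k → R ≤ (x j - x k).natAbs) (hfar : ∀ j k, R ≤ (x j - z k).natAbs)
    (hside : ∀ j k, (z k < c ∧ z k < x j) ∨ (c < z k ∧ x j < z k))
    (hnear : ∀ k, (x k - z k).natAbs < 3 * R) : False := by
  obtain ⟨b, hb⟩ := Fintype.exists_lt_card_fiber_of_mul_lt_card
    (fun k => decide (z k < c)) (n := 2) (by simp)
  obtain ⟨j, hj, k, hk, l, hl, hjk, hjl, hkl⟩ := Finset.two_lt_card.mp hb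
  simp only [Finset.mem_filter, Finset.mem_univ, true_and] at hj hk hl
  have := hsep j k hjk
  have := hsep j l hjl
  have := hsep k l hkl
  have far (i i') := And.intro (hfar i i') (hside i i')
  have := far j j
  have := far j k
  have := far j l
  have := far k j
  have := far k k
  have := far k l
  have := far l j
  have := far l k
  have := far l l
  have := hnear j
  have := hnear k
  have := hnear l
  cases b <;> simp only [decide_eq_false_iff_not, decide_eq_true_eq] at hj hk hl <;> omega

/-- As long as `v` is not covered, each of five greedy steps would add a point to the gap of `v`. -/
theorem isCovering_greedyStep_iterate (hG : LineMetric G) (hR : 1 ≤ R)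
    (hℓ : Function.Injective ℓ) (hU : U.Finite) {S₀ : Set V}
    (hS₀ : IsCovering G U S₀ (3 * R - 1)) {n : ℕ} (hn : 4 ≤ n) :
    IsCovering G U ((greedyStep G ℓ U R)^[n] S₀) (R - 1) := by
  intro v hv
  by_contra! huncovered
  obtain ⟨pos, hpos⟩ := hG v
  have hcand (k : Fin 5) : v ∈ candidates G U R ((greedyStep G ℓ U R)^[k] S₀) := by
    refine mem_candidates_iff.mpr ⟨hv, fun s hs => ?_⟩
    have hs := huncovered s (greedyStep_iterate_mono (by omega) hs)
    rwa [← not_le, ← edist_lt_iff_le_pred hR, not_lt] at hs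
  choose x hx hxcand hgap using fun k : Fin 5 =>
    exists_mem_greedyStep_of_sameGap hR hℓ hU hpos (subset_greedyStep_iterate k) (hcand k)
  choose s hs hxs using fun k => hS₀ (x k) (hxcand k).1
  have hreach (k) : G.Reachable v (s k) := (hgap k).1.trans (reachable_of_edist_le (hxs k))
  have hsep_of_lt {j k : Fin 5} (hjk : j < k) : R ≤ (pos (x k) - pos (x j)).natAbs := by
    have hmem : x j ∈ (greedyStep G ℓ U R)^[k] S₀ := by
      refine greedyStep_iterate_mono (Nat.succ_le_of_lt hjk) ?_
      rw [Function.iterate_succ_apply']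
      exact hx j
    exact (hpos.le_edist_iff (hgap k).1 (hgap j).1).mp
      ((mem_candidates_iff.mp (hxcand k)).2 _ hmem)
  refine not_five_separated_in_gap (R := R) (c := pos v) (x := pos ∘ x) (z := pos ∘ s)
    (fun j k hjk => ?_) (fun j k => ?_) (fun j k => (hgap j).2 (s k) (hs k) (hreach k))
    (fun k => ?_)
  · rcases lt_or_gt_of_ne hjk with h | h
    · have := hsep_of_lt h
      simp only [Function.comp_apply]
      omega
    · exact hsep_of_lt h
  · exact (hpos.le_edist_iff (hgap j).1 (hreach k)).mp
      ((mem_candidates_iff.mp (hxcand j)).2 _ (subset_greedyStep_iterate _ (hs k)))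
  · have := (hpos.edist_le_iff (hgap k).1 (hreach k)).mp (hxs k)
    simp only [Function.comp_apply]
    omega

end Greedy

section PathRulingSet

variable {V : Type*} {G : SimpleGraph V} {ℓ : V → ℕ} {U : Set V} {R : ℕ}

/-- `M 1, …, M n` are sets that the first `n` iterations of `PathRulingSet` may compute from
`M 0`. -/
def IsMISChain (G : SimpleGraph V) (R n : ℕ) (M : ℕ → Set V) : Prop :=
  ∀ i, 1 ≤ i → i ≤ n → IsMISOn (powerGraph G (misRadius R i)) (M (i - 1)) (M i)

/-- The sum of the radii `R_1, …, R_n`. -/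
def misRadiusSum (R n : ℕ) : ℕ := ∑ j ∈ Finset.range n, misRadius R (j + 1)

theorem misRadiusSum_succ (R n : ℕ) :
    misRadiusSum R (n + 1) = misRadiusSum R n + misRadius R (n + 1) :=
  Finset.sum_range_succ _ _

theorem misRadiusSum_add_two_le {n : ℕ} (hn : n + 1 ≤ Nat.clog 2 R) :
    misRadiusSum R n + 2 ≤ 2 ^ (n + 1) := by
  induction n with
  | zero => simp [misRadiusSum]
  | succ n ih =>
    have hsum := ih (by omega)
    have hradius : misRadius R (n + 1) = 2 ^ (n + 1) - 1 := if_pos hn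
    rw [misRadiusSum_succ, hradius, pow_succ 2 (n + 1)]
    omega

theorem misRadiusSum_lt (hR : 1 ≤ R) : misRadiusSum R (Nat.clog 2 R) < 3 * R := by
  rcases hn : Nat.clog 2 R with _ | n
  · rw [misRadiusSum, Finset.sum_range_zero]
    omega
  · have hsum := misRadiusSum_add_two_le (R := R) (n := n) (by omega)
    have hradius : misRadius R (n + 1) = R - 1 := if_neg (by omega)
    have hpow : 2 ^ n < R := by rw [← Nat.lt_clog_iff_pow_lt (by norm_num)]; omega
    rw [misRadiusSum_succ, hradius]
    rw [pow_succ] at hsum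
    omega

theorem misRadius_succ_lt {n : ℕ} (hn : n + 1 ≤ Nat.clog 2 R) :
    misRadius R (n + 1) < (1 + 1) * 2 ^ n := by
  have hpos : 0 < 2 ^ n := by positivity
  rw [misRadius]
  split_ifs with h
  · omega
  · have hclog := Nat.le_pow_clog (b := 2) (by norm_num) R
    rw [show Nat.clog 2 R = n + 1 by omega] at hclog
    omega

theorem IsMISOn.isPacking {k : ℕ} {S : Set V} (h : IsMISOn (powerGraph G k) U S) :
    IsPacking G (k + 1) S := by
  intro u hu v hv huv
  by_contra hlt
  rw [not_le, edist_lt_iff_le_pred (by omega)] at hlt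
  exact h.independent u hu v hv ⟨huv, hlt⟩

theorem IsMISOn.isCovering {k : ℕ} {S : Set V} (h : IsMISOn (powerGraph G k) U S) :
    IsCovering G U S k := by
  intro u hu
  by_cases hS : u ∈ S
  · exact ⟨u, hS, by simp⟩
  · obtain ⟨v, hv, hadj⟩ := h.dominating u hu hS
    exact ⟨v, hv, hadj.2⟩

namespace IsMISChain

variable {M : ℕ → Set V} {n : ℕ}

theorem of_succ (h : IsMISChain G R (n + 1) M) : IsMISChain G R n M :=
  fun i h₁ h₂ => h i h₁ (by omega)

theorem subset (h : IsMISChain G R n M) : M n ⊆ M 0 := by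
  induction n with
  | zero => exact subset_rfl
  | succ n ih => exact (h (n + 1) (by omega) le_rfl).subset.trans (ih h.of_succ)

theorem isCovering (h : IsMISChain G R n M) : IsCovering G (M 0) (M n) (misRadiusSum R n) := by
  induction n with
  | zero => exact .refl _
  | succ n ih =>
    rw [misRadiusSum_succ]
    exact (ih h.of_succ).trans (h (n + 1) (by omega) le_rfl).isCovering

theorem isPacking (hR : 1 ≤ R) (h : IsMISChain G R (Nat.clog 2 R) M) :
    IsPacking G R (M (Nat.clog 2 R)) := by
  rcases Nat.eq_zero_or_pos (Nat.clog 2 R) with hclog | hclog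
  · have hR1 : R = 1 := by
      have := Nat.le_pow_clog (b := 2) (by norm_num) R
      rw [hclog] at this
      omega
    subst hR1
    exact isPacking_one _
  · have hpacking := (h _ hclog le_rfl).isPacking
    rwa [show misRadius R (Nat.clog 2 R) = R - 1 from if_neg (by omega),
      Nat.sub_add_cancel hR] at hpacking

theorem isPacking_two_pow (hn : n + 1 ≤ Nat.clog 2 R) (h : IsMISChain G R n M) :
    IsPacking G (2 ^ n) (M n) := by
  rcases Nat.eq_zero_or_pos n with rfl | hpos
  · exact isPacking_one _
  · have hpacking := (h n hpos le_rfl).isPacking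
    rwa [show misRadius R n = 2 ^ n - 1 from if_pos hn,
      Nat.sub_add_cancel Nat.one_le_two_pow] at hpacking

end IsMISChain

theorem IsPathRulingSetResult.isLimitedRulingSet (hG : LineMetric G) (hR : 1 ≤ R)
    (hℓ : Function.Injective ℓ) (hU : U.Finite) {P : Set V}
    (h : IsPathRulingSetResult G ℓ U R P) : IsLimitedRulingSet G U P R (R - 1) := by
  obtain ⟨M, rfl, hM, rfl⟩ := h
  have hM : IsMISChain G R (Nat.clog 2 R) M := hM
  exact
    { subset := (greedyStep_iterate_subset 6).trans (Set.union_subset hM.subset subset_rfl)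
      packing := isPacking_greedyStep_iterate hR (hM.isPacking hR) 6
      covering := isCovering_greedyStep_iterate hG hR hℓ hU
        (hM.isCovering.mono subset_rfl (Nat.le_sub_one_of_lt (misRadiusSum_lt hR)))
        (by norm_num) }

end PathRulingSet

section Trace

variable {V : Type*} {G : SimpleGraph V} {ℓ : V → ℕ} {R : ℕ}

/-- `S` together with the points of `P` that are not within distance `R - 1` of `S`. -/
def mergeFar (G : SimpleGraph V) (R : ℕ) (S P : Set V) : Set V :=
  S ∪ (P \ neighborhood G (R - 1) S)

theorem isCovering_mergeFar (hR : 1 ≤ R) {U P S : Set V} (hP : IsCovering G U P (R - 1)) :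
    IsCovering G U (mergeFar G R S P) (3 * R - 1) := by
  have hmerge : IsCovering G P (mergeFar G R S P) (R - 1) := by
    intro p hp
    by_cases hnear : p ∈ neighborhood G (R - 1) S
    · obtain ⟨s, hs, hd⟩ := hnear
      exact ⟨s, Or.inl hs, hd⟩
    · exact ⟨p, Or.inr ⟨hp, hnear⟩, by simp⟩
  exact (hP.trans hmerge).mono subset_rfl (by omega)

theorem isPacking_mergeFar (hR : 1 ≤ R) {P S : Set V} (hP : IsPacking G R P)
    (hS : IsPacking G R S) : IsPacking G R (mergeFar G R S P) := by
  have hfar : ∀ u ∈ S, ∀ v ∈ P \ neighborhood G (R - 1) S, (R : ℕ∞) ≤ G.edist v u := by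
    intro u hu v hv
    by_contra hlt
    rw [not_le, edist_lt_iff_le_pred hR] at hlt
    exact hv.2 ⟨u, hu, hlt⟩
  rintro u (hu | hu) v (hv | hv) huv
  · exact hS u hu v hv huv
  · rw [SimpleGraph.edist_comm]; exact hfar u hu v hv
  · exact hfar v hv u hu
  · exact hP u hu.1 v hv.1 huv

/-- The part of `IsESColTrace` that concerns the sets; it does not involve the colors. -/
structure IsSetTrace (G : SimpleGraph V) (ℓ : V → ℕ) (R : ℕ) (S : ℕ → Set V) : Prop where
  start : S 0 = ∅
  extend : ∀ i, ∃ P : Set V, IsPathRulingSetResult G ℓ (labelClass ℓ (i + 1)) R P ∧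
    S (i + 1) = (greedyStep G ℓ (labelClass ℓ (i + 1)) R)^[4] (mergeFar G R (S i) P)

variable {S : ℕ → Set V} {χ : V → Fin 17}

theorem IsESColTrace.isSetTrace (h : IsESColTrace G ℓ R S χ) : IsSetTrace G ℓ R S :=
  ⟨h.start, fun i => h.extend (i + 1) (by omega)⟩

namespace IsSetTrace

theorem mono (h : IsSetTrace G ℓ R S) : Monotone S := by
  refine monotone_nat_of_le_succ fun i => ?_
  obtain ⟨P, -, hS⟩ := h.extend i
  rw [hS]
  exact Set.subset_union_left.trans (subset_greedyStep_iterate 4)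

theorem isLimitedRulingSet (hG : LineMetric G) (hR : 1 ≤ R) (hℓ : Function.Injective ℓ)
    (h : IsSetTrace G ℓ R S) (i : ℕ) :
    IsLimitedRulingSet G {v | logStar (ℓ v) ≤ i} (S i) R (R - 1) := by
  induction i with
  | zero =>
    have hempty : {v | logStar (ℓ v) ≤ 0} = ∅ :=
      Set.eq_empty_of_forall_notMem fun v => (one_le_logStar (ℓ v)).not_gt ∘ Nat.lt_succ_of_le
    rw [h.start, hempty]
    exact ⟨subset_rfl, by simp, by simp⟩
  | succ i ih =>
    obtain ⟨P, hP, hS⟩ := h.extend i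
    have hfin := finite_labelClass hℓ (i + 1)
    have hP := hP.isLimitedRulingSet hG hR hℓ hfin
    refine ⟨?_, ?_, fun u hu => ?_⟩
    · rw [hS]
      refine (greedyStep_iterate_subset 4).trans ?_
      rintro v ((hv | hv) | hv)
      · exact Nat.le_succ_of_le (ih.subset hv)
      · exact (hP.subset hv.1).le
      · exact hv.le
    · rw [hS]
      exact isPacking_greedyStep_iterate hR (isPacking_mergeFar hR hP.packing ih.packing) 4
    · rcases Nat.le_or_eq_of_le_succ hu with hu | hu
      · exact (show IsCovering G _ _ _ from ih.covering).mono (h.mono i.le_succ) le_rfl u hu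
      · rw [hS]
        exact isCovering_greedyStep_iterate hG hR hℓ hfin
          (isCovering_mergeFar hR hP.covering) le_rfl u hu

theorem logStar_eq_of_mem_diff (hG : LineMetric G) (hR : 1 ≤ R) (hℓ : Function.Injective ℓ)
    (h : IsSetTrace G ℓ R S) {i : ℕ} {v : V} (hv : v ∈ S (i + 1) \ S i) :
    logStar (ℓ v) = i + 1 := by
  obtain ⟨P, hP, hS⟩ := h.extend i
  have hP := hP.isLimitedRulingSet hG hR hℓ (finite_labelClass hℓ (i + 1))
  rcases greedyStep_iterate_subset 4 (hS ▸ hv.1) with (hvS | hvP) | hvU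
  · exact absurd hvS hv.2
  · exact hP.subset hvP.1
  · exact hvU

theorem mem_of_mem (hG : LineMetric G) (hR : 1 ≤ R) (hℓ : Function.Injective ℓ)
    (h : IsSetTrace G ℓ R S) {i : ℕ} {v : V} (hv : v ∈ S i) : v ∈ S (logStar (ℓ v)) := by
  induction i with
  | zero => rw [h.start] at hv; exact hv.elim
  | succ i ih =>
    by_cases hvi : v ∈ S i
    · exact ih hvi
    · rwa [h.logStar_eq_of_mem_diff hG hR hℓ ⟨hv, hvi⟩]

end IsSetTrace

theorem IsESColTrace.proper (h : IsESColTrace G ℓ R S χ) (i : ℕ) :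
    ∀ u ∈ S i, ∀ v ∈ S i, (powerGraph G (9 * R - 1)).Adj u v → χ u ≠ χ v := by
  induction i with
  | zero => intro u hu; rw [h.start] at hu; exact hu.elim
  | succ i ih =>
    have hcolor := h.color (i + 1) (by omega)
    rw [Nat.add_sub_cancel] at hcolor
    have hold_new : ∀ u ∈ S (i + 1) \ S i, ∀ v ∈ S i,
        (powerGraph G (9 * R - 1)).Adj u v → χ u ≠ χ v := fun u hu v hv hadj =>
      hcolor.mem_list u hu v ⟨hv, u, rfl, by rw [SimpleGraph.edist_comm]; exact hadj.2⟩
    intro u hu v hv hadj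
    by_cases hui : u ∈ S i <;> by_cases hvi : v ∈ S i
    · exact ih u hui v hvi hadj
    · exact (hold_new v ⟨hv, hvi⟩ u hui hadj.symm).symm
    · exact hold_new u ⟨hu, hui⟩ v hvi hadj
    · exact hcolor.proper u ⟨hu, hui⟩ v ⟨hv, hvi⟩ hadj

end Trace

section Run

variable {V : Type*} {G : SimpleGraph V} {ℓ : V → ℕ} {R : ℕ} {T : ℕ → ℕ}
  {out : ℕ → V → Option NodeOutput}

theorem exists_forall_le_iff_of_strictMono (hT : StrictMono T) (t : ℕ) :
    ∃ k, ∀ i, 1 ≤ i → (T i ≤ t ↔ i ≤ k) := by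
  have hlate : ∃ k, t < T (k + 1) := ⟨t, hT.id_le (t + 1)⟩
  classical
  refine ⟨Nat.find hlate, fun i hi => ?_⟩
  obtain ⟨j, rfl⟩ := Nat.exists_eq_add_of_le' hi
  rw [Nat.add_one_le_iff, Nat.lt_find_iff]
  simp only [not_lt]
  exact ⟨fun h m hm => (hT.monotone (by omega)).trans h, fun h => h j le_rfl⟩

open Classical in
theorem IsESColRun.exists_snapshot (hG : LineMetric G) (hR : 1 ≤ R) (hℓ : Function.Injective ℓ)
    (h : IsESColRun G ℓ R T out) (t : ℕ) :
    ∃ S χ k, IsESColTrace G ℓ R S χ ∧ terminatedSet out t = {v | logStar (ℓ v) ≤ k} ∧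
      (∀ v, colorAt out t v = if v ∈ S k then some (χ v) else none) ∧
      ∀ v, TerminatesInRound out v t → out t v = some (committedOutput G ℓ R (S k) χ v) := by
  obtain ⟨hT, S, χ, htrace, hout⟩ := h
  obtain ⟨k, hk⟩ := exists_forall_le_iff_of_strictMono hT t
  have hT_le (v) : T (logStar (ℓ v)) ≤ t ↔ logStar (ℓ v) ≤ k := hk _ (one_le_logStar _)
  have hmem_terminated (v s) : v ∈ terminatedSet out s ↔ T (logStar (ℓ v)) ≤ s := by
    simp only [terminatedSet, Set.mem_ofPred_eq, hout]
    split_ifs with h <;> simp [h]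
  refine ⟨S, χ, k, htrace, ?_, fun v => ?_, fun v hv => ?_⟩
  · ext v
    rw [hmem_terminated, hT_le]; rfl
  · have hsubset := (htrace.isSetTrace.isLimitedRulingSet hG hR hℓ k).subset
    simp only [colorAt, hout, hT_le]
    by_cases hvk : logStar (ℓ v) ≤ k
    · have hmem : v ∈ S (logStar (ℓ v)) ↔ v ∈ S k :=
        ⟨fun hv => htrace.isSetTrace.mono hvk hv, htrace.isSetTrace.mem_of_mem hG hR hℓ⟩
      simp only [hvk, if_true, Option.bind_some, committedOutput, hmem]
    · have hvS : v ∉ S k := fun hv => hvk (hsubset hv)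
      simp [hvk, hvS]
  · have hvt := (hmem_terminated v t).mp hv.1
    have hTv : T (logStar (ℓ v)) = t :=
      hvt.antisymm (not_lt.mp fun hlt => hv.2 _ hlt ((hmem_terminated v _).mpr le_rfl))
    have hvk := (hT_le v).mp hvt
    have hkt : T k ≤ t := (hk k ((one_le_logStar _).trans hvk)).mpr le_rfl
    rw [hout, if_pos hvt, hT.injective.eq_iff.mp ((hT.monotone hvk).antisymm (hTv ▸ hkt))]

/-- The guarantees of the procedure in round `t`: the outputs so far form a properly colored
ruling set, and the vertices that terminate know its part near them. -/
def IsCorrectAt (G : SimpleGraph V) (ℓ : V → ℕ) (R : ℕ) (out : ℕ → V → Option NodeOutput)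
    (t : ℕ) : Prop :=
  IsLimitedRulingSet G (terminatedSet out t) (joinedSet out t) R (R - 1) ∧
  (∃ χ : ((powerGraph G (9 * R - 1)).induce (joinedSet out t)).Coloring (Fin 17),
    ∀ v : joinedSet out t, colorAt out t v = some (χ v)) ∧
  (∀ v : V, TerminatesInRound out v t → ∃ o : NodeOutput, out t v = some o ∧
    ∀ (a : ℕ) (c : Fin 17), (a, c) ∈ o.nearby ↔
      ∃ u ∈ joinedSet out t, G.edist v u < R ∧ ℓ u = a ∧ colorAt out t u = some c)

theorem IsESColRun.isCorrectAt (hG : LineMetric G) (hR : 1 ≤ R) (hℓ : Function.Injective ℓ)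
    (h : IsESColRun G ℓ R T out) (t : ℕ) : IsCorrectAt G ℓ R out t := by
  classical
  obtain ⟨S, χ, k, htrace, hterminated, hcolor, hcommitted⟩ := h.exists_snapshot hG hR hℓ t
  have hjoined : joinedSet out t = S k := by
    ext v
    simp only [joinedSet, Set.mem_ofPred_eq, hcolor]
    split_ifs with hv <;> simp [hv]
  refine ⟨?_, ?_, fun v hv => ⟨_, hcommitted v hv, fun a c => ?_⟩⟩
  · rw [hterminated, hjoined]
    exact htrace.isSetTrace.isLimitedRulingSet hG hR hℓ k
  · rw [hjoined]
    exact ⟨.mk (fun v => χ v) fun {u v} hadj => htrace.proper k u u.2 v v.2 hadj,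
      fun v => (hcolor v).trans (if_pos v.2)⟩
  · have hcolor_eq (u) (hu : u ∈ S k) : colorAt out t u = some c ↔ χ u = c := by simp [hcolor, hu]
    simp only [committedOutput, Set.mem_ofPred_eq, Prod.mk.injEq, hjoined,
      edist_lt_iff_le_pred hR]
    refine exists_congr fun u => and_congr_right fun hu => ?_
    rw [hcolor_eq u hu, eq_comm (a := a), eq_comm (a := c)]

end Run

section Locality

/-- The view of radius `r` from `a`: the edges of `H` at the vertices at distance less than `r`
from `a`. This is what `a` can learn in `r` rounds when vertices are identified with their
labels. -/
def view (H : SimpleGraph ℕ) (r a : ℕ) : Set (ℕ × ℕ) :=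
  {p | H.Adj p.1 p.2 ∧ H.edist a p.1 < r}

variable {H H' : SimpleGraph ℕ} {r k a b n x y : ℕ}

theorem edist_le_of_view_subset (h : view H (r + k) a ⊆ view H' (r + k) a)
    (hb : H.edist a b ≤ k) (hn : n ≤ r) (hx : H.edist b x ≤ n) : H'.edist b x ≤ n := by
  induction n generalizing x with
  | zero => simpa using hx
  | succ n ih =>
    rw [edist_le_succ_iff'] at hx ⊢
    refine hx.imp_right fun ⟨y, hy, hyx⟩ => ⟨y, ih (by omega) hy, ?_⟩
    have hay : H.edist a y < (r + k : ℕ) :=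
      (edist_le_add hb hy).trans_lt (by exact_mod_cast (by omega))
    exact (h (show (y, x) ∈ view H (r + k) a from ⟨hyx, hay⟩)).1

theorem view_subset_of_edist_le (h : view H (r + k) a ⊆ view H' (r + k) a)
    (hb : H.edist a b ≤ k) : view H r b ⊆ view H' r b := by
  rcases Nat.eq_zero_or_pos r with rfl | hr
  · exact fun p hp => by simp [view] at hp
  rintro ⟨x, y⟩ ⟨hxy, hx⟩
  rw [edist_lt_iff_le_pred hr] at hx
  have hax : H.edist a x < (r + k : ℕ) :=
    (edist_le_add hb hx).trans_lt (by exact_mod_cast (by omega))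
  refine ⟨(h (show (x, y) ∈ view H (r + k) a from ⟨hxy, hax⟩)).1, ?_⟩
  rw [edist_lt_iff_le_pred hr]
  exact edist_le_of_view_subset h hb (Nat.sub_le r 1) hx

theorem edist_le_iff_of_view_eq (h : view H r a = view H' r a) (hn : n ≤ r) :
    H.edist a x ≤ n ↔ H'.edist a x ≤ n :=
  ⟨edist_le_of_view_subset (k := 0) h.subset (by simp) hn,
    edist_le_of_view_subset (k := 0) h.superset (by simp) hn⟩

theorem view_eq_of_edist_le (h : view H (r + k) a = view H' (r + k) a) (hb : H.edist a b ≤ k) :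
    view H r b = view H' r b :=
  have hb' : H'.edist a b ≤ k := (edist_le_iff_of_view_eq h (Nat.le_add_left k r)).mp hb
  (view_subset_of_edist_le h.subset hb).antisymm (view_subset_of_edist_le h.superset hb')

theorem view_eq_of_le (h : view H r a = view H' r a) (hk : k ≤ r) :
    view H k a = view H' k a := by
  obtain ⟨m, rfl⟩ := Nat.exists_eq_add_of_le hk
  exact view_eq_of_edist_le h (by simp)

/-- A quantity `F` attached to the vertices of labeled lines, which are identified with their
labels, is determined by views of radius `ρ` if its value at `a` only depends on the view of
radius `ρ a` from `a`. -/
def IsDeterminedByView {α : Type*} (ρ : ℕ → ℕ) (F : SimpleGraph ℕ → ℕ → α) : Prop :=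
  ∀ H₁ H₂, LineMetric H₁ → LineMetric H₂ →
    ∀ a, view H₁ (ρ a) a = view H₂ (ρ a) a → F H₁ a = F H₂ a

/-- A quantity is `r`-local if it is determined by views of the same radius `r` at all vertices. -/
def IsLocal {α : Type*} (r : ℕ) (F : SimpleGraph ℕ → ℕ → α) : Prop :=
  IsDeterminedByView (fun _ => r) F

/-- Locality of a set: a vertex can tell from its view of radius `r` whether it is a member. -/
abbrev IsLocalSet (r : ℕ) (S : SimpleGraph ℕ → Set ℕ) : Prop := IsLocal r fun H a => a ∈ S H

namespace IsLocal

variable {α β γ : Type*} {F : SimpleGraph ℕ → ℕ → α} {F' : SimpleGraph ℕ → ℕ → β}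

theorem mono (h : IsLocal r F) (hk : r ≤ k) : IsLocal k F :=
  fun H H' hH hH' a ha => h H H' hH hH' a (view_eq_of_le ha hk)

theorem const (F : ℕ → α) : IsLocal r fun _ => F := fun _ _ _ _ _ _ => rfl

theorem map (h : IsLocal r F) (g : ℕ → α → β) : IsLocal r fun H a => g a (F H a) :=
  fun H H' hH hH' a ha => by simp only [h H H' hH hH' a ha]

theorem congr {F₁ : SimpleGraph ℕ → ℕ → α} (h : IsLocal r F)
    (hF : ∀ H, LineMetric H → ∀ a, F H a = F₁ H a) : IsLocal r F₁ := fun H H' hH hH' a ha => by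
  rw [← hF H hH, ← hF H' hH', h H H' hH hH' a ha]

theorem map₂ (h : IsLocal r F) (h' : IsLocal r F') (g : ℕ → α → β → γ) :
    IsLocal r fun H a => g a (F H a) (F' H a) := fun H H' hH hH' a ha => by
  simp only [h H H' hH hH' a ha, h' H H' hH hH' a ha]

theorem setOf {F : β → SimpleGraph ℕ → ℕ → Prop} (h : ∀ z, IsLocal r (F z)) :
    IsLocal r fun H a => {z | F z H a} := fun H H' hH hH' a ha =>
  Set.ext fun z => iff_of_eq (h z H H' hH hH' a ha)

theorem exists_edist_le (h : IsLocal r F) (k : ℕ) (p : ℕ → α → ℕ → α → Prop) :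
    IsLocal (r + k) fun H a => ∃ b, H.edist a b ≤ k ∧ p a (F H a) b (F H b) := by
  intro H H' hH hH' a ha
  have hF {b : ℕ} (hb : H.edist a b ≤ k) : F H b = F H' b :=
    h H H' hH hH' b (view_eq_of_edist_le ha hb)
  refine propext (exists_congr fun b => ?_)
  rw [← edist_le_iff_of_view_eq ha (Nat.le_add_left k r), hF (b := a) (by simp)]
  exact and_congr_right fun hb => by rw [hF hb]

theorem image_powerGraph (h : IsLocal r F) {A : SimpleGraph ℕ → Set ℕ} (hA : IsLocalSet r A)
    (k : ℕ) (g : α → α → β) :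
    IsLocal (r + k) fun H a =>
      (fun b => g (F H a) (F H b)) '' {b ∈ A H | (powerGraph H k).Adj a b} := by
  have hset : IsLocal (r + k) fun H a => {z | ∃ b, H.edist a b ≤ k ∧
      a ≠ b ∧ b ∈ A H ∧ g (F H a) (F H b) = z} :=
    setOf fun z => (h.map₂ hA fun _ => Prod.mk).exists_edist_le k
      fun a c b d => a ≠ b ∧ d.2 ∧ g c.1 d.1 = z
  refine hset.congr fun H _ a => Set.ext fun z => exists_congr fun b =>
    ⟨fun ⟨hd, hne, hb, hz⟩ => ⟨⟨hb, hne, hd⟩, hz⟩, fun ⟨⟨hb, hne, hd⟩, hz⟩ => ⟨hd, hne, hb, hz⟩⟩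

end IsLocal

namespace IsLocalSet

variable {S S' : SimpleGraph ℕ → Set ℕ}

theorem union (h : IsLocalSet r S) (h' : IsLocalSet r S') : IsLocalSet r fun H => S H ∪ S' H :=
  h.map₂ h' fun _ => Or

theorem sdiff (h : IsLocalSet r S) (h' : IsLocalSet r S') : IsLocalSet r fun H => S H \ S' H :=
  h.map₂ h' fun _ p q => p ∧ ¬ q

theorem exists_mem_edist_le (h : IsLocalSet r S) (k : ℕ) :
    IsLocal (r + k) fun H a => ∃ s ∈ S H, H.edist a s ≤ k :=
  (h.exists_edist_le k fun _ _ _ hs => hs).congr fun _ _ _ => by simp only [and_comm]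

theorem mergeFar (h : IsLocalSet r S) (h' : IsLocalSet r S') {R : ℕ} :
    IsLocalSet (r + R) fun H => mergeFar H R (S H) (S' H) :=
  have hnear : IsLocalSet (r + R) fun H => neighborhood H (R - 1) (S H) :=
    (h.exists_mem_edist_le (R - 1)).mono (by omega)
  union (S := S) (h.mono (Nat.le_add_right r R))
    (sdiff (S := S') (h'.mono (Nat.le_add_right r R)) hnear)

end IsLocalSet

end Locality

section ColorReduction

/-- The least position where the binary expansions of `a` and `b` differ (`0` if `a = b`). -/
noncomputable def differBit (a b : ℕ) : ℕ := sInf {k | a.testBit k ≠ b.testBit k}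

theorem testBit_differBit_ne {a b : ℕ} (h : a ≠ b) :
    a.testBit (differBit a b) ≠ b.testBit (differBit a b) :=
  Nat.sInf_mem (s := {k | a.testBit k ≠ b.testBit k}) (Nat.exists_testBit_ne_of_ne h)

theorem differBit_lt {a b m : ℕ} (h : a ≠ b) (ha : a < 2 ^ m) (hb : b < 2 ^ m) :
    differBit a b < m := by
  by_contra! hm
  have hle : 2 ^ m ≤ 2 ^ differBit a b := Nat.pow_le_pow_right (by norm_num) hm
  apply testBit_differBit_ne h
  rw [Nat.testBit_lt_two_pow (ha.trans_le hle), Nat.testBit_lt_two_pow (hb.trans_le hle)]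

/-- The position of a bit where `a` differs from `b`, together with that bit of `a`. -/
noncomputable def bitMark (a b : ℕ) : ℕ :=
  Nat.bit (a.testBit (differBit a b)) (differBit a b)

theorem bitMark_lt {a b m : ℕ} (h : a ≠ b) (ha : a < 2 ^ m) (hb : b < 2 ^ m) :
    bitMark a b < 2 * m := by
  have hlt := differBit_lt h ha hb
  have hbit := Bool.toNat_le (a.testBit (differBit a b))
  rw [bitMark, Nat.bit_val]
  omega

theorem bitMark_ne {a b : ℕ} (h : a ≠ b) (c : ℕ) : bitMark a b ≠ bitMark b c := fun he => by
  have hpos : differBit a b = differBit b c := by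
    simpa [bitMark, Nat.bit_div_two] using congrArg (fun n : ℕ => n / 2) he
  have hbit : a.testBit (differBit a b) = b.testBit (differBit b c) := by
    simpa only [bitMark, Nat.testBit_bit_zero] using congrArg (Nat.testBit · 0) he
  exact testBit_differBit_ne h (hpos ▸ hbit)

open Classical in
/-- A code for the nonempty subsets of `{0, …, B - 1}` with at most `Δ` elements, which are the
ranges of the functions `Fin Δ → Fin B` if `Δ ≠ 0`. -/
noncomputable def setCode (Δ B : ℕ) (A : Set ℕ) : ℕ :=
  if h : ∃ f : Fin Δ → Fin B, Set.range (fun j => (f j : ℕ)) = A then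
    finFunctionFinEquiv h.choose else 0

theorem setCode_lt {Δ B N : ℕ} (hN : 0 < N) (hB : B ^ Δ ≤ N) (A : Set ℕ) :
    setCode Δ B A < N := by
  unfold setCode
  split_ifs with h
  · exact (finFunctionFinEquiv h.choose).2.trans_le hB
  · exact hN

theorem exists_range_eq {Δ B : ℕ} {A : Set ℕ} (hA : A.Nonempty) (hcard : A.encard ≤ Δ)
    (hB : ∀ z ∈ A, z < B) : ∃ f : Fin Δ → Fin B, Set.range (fun j => (f j : ℕ)) = A := by
  have hfin : A.Finite := Set.finite_of_encard_le_coe hcard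
  have : Fintype A := hfin.fintype
  have : Nonempty A := hA.to_subtype
  have hle : Fintype.card A ≤ Fintype.card (Fin Δ) := by
    rw [Fintype.card_fin]
    exact_mod_cast (Set.coe_fintypeCard A).trans_le hcard
  obtain ⟨g⟩ := Function.Embedding.nonempty_of_card_le hle
  have hsurj : Function.Surjective (Function.invFun g) := Function.invFun_surjective g.injective
  refine ⟨fun j => ⟨(Function.invFun g j : A), hB _ (Function.invFun g j : A).2⟩, ?_⟩
  exact (hsurj.range_comp Subtype.val).trans Subtype.range_coe

theorem setCode_inj {Δ B : ℕ} {A A' : Set ℕ}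
    (hA : ∃ f : Fin Δ → Fin B, Set.range (fun j => (f j : ℕ)) = A)
    (hA' : ∃ f : Fin Δ → Fin B, Set.range (fun j => (f j : ℕ)) = A')
    (h : setCode Δ B A = setCode Δ B A') : A = A' := by
  unfold setCode at h
  rw [dif_pos hA, dif_pos hA'] at h
  rw [← hA.choose_spec, ← hA'.choose_spec, finFunctionFinEquiv.injective (Fin.ext h)]

/-- One round of Linial's color reduction on `P[U]`: the new color of `x` encodes the set of the
bits of its color `c x`, a number of `m` bits, that distinguish it from its neighbors. -/
noncomputable def reduceColor {V : Type*} (P : SimpleGraph V) (U : Set V) (Δ m : ℕ) (c : V → ℕ)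
    (x : V) : ℕ :=
  setCode Δ (2 * m) ((fun y => bitMark (c x) (c y)) '' {y ∈ U | P.Adj x y})

/-- If adjacent `x` and `y` had the same new color, then the mark that distinguishes `x` from `y`
would also distinguish `y` from one of its neighbors. -/
theorem isListColoringOn_reduceColor {V : Type*} {P : SimpleGraph V} {U : Set V} {Δ m N : ℕ}
    {c : V → ℕ} (hdeg : ∀ x ∈ U, {y ∈ U | P.Adj x y}.encard ≤ Δ) (hN : 0 < N)
    (hm : (2 * m) ^ Δ ≤ N) (hc : IsListColoringOn P U (fun _ => Set.Iio (2 ^ m)) c) :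
    IsListColoringOn P U (fun _ => Set.Iio N) (reduceColor P U Δ m c) := by
  refine ⟨fun x _ => setCode_lt hN hm _, fun x hx y hy hxy he => ?_⟩
  have hrange {x y : V} (hx : x ∈ U) (hy : y ∈ U) (hxy : P.Adj x y) :
      ∃ f : Fin Δ → Fin (2 * m), Set.range (fun j => (f j : ℕ)) =
        (fun y => bitMark (c x) (c y)) '' {y ∈ U | P.Adj x y} := by
    refine exists_range_eq ⟨_, y, ⟨hy, hxy⟩, rfl⟩ ((Set.encard_image_le _ _).trans (hdeg x hx)) ?_
    rintro _ ⟨z, ⟨hz, hxz⟩, rfl⟩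
    exact bitMark_lt (hc.proper x hx z hz hxz) (hc.mem_list x hx) (hc.mem_list z hz)
  have hmarks := setCode_inj (hrange hx hy hxy) (hrange hy hx hxy.symm) he
  obtain ⟨z, -, hz⟩ := hmarks.subset ⟨y, ⟨hy, hxy⟩, rfl⟩
  exact bitMark_ne (hc.proper x hx y hy hxy) _ hz.symm

/-- Bounds the number of bits of the colors on `Δ`-bounded graphs that remain when the iterated
logarithm of the colors has dropped to `j + 1`. -/
def paletteBits (Δ j : ℕ) : ℕ := 4 ^ Δ * tower j

theorem le_paletteBits (Δ j : ℕ) : tower j ≤ paletteBits Δ j :=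
  Nat.le_mul_of_pos_left _ (by positivity)

theorem two_mul_paletteBits_pow_le (Δ j : ℕ) :
    (2 * paletteBits Δ j) ^ Δ ≤ 2 ^ paletteBits Δ (j - 1) := by
  have htower : tower j ≤ 2 ^ tower (j - 1) := by
    cases j with
    | zero => exact Nat.lt_two_pow_self.le
    | succ j => exact le_rfl
  have hΔ : (2 * Δ + 2) * Δ ≤ 4 ^ Δ := by
    have h₁ : Δ + 1 ≤ 2 ^ Δ := Nat.lt_two_pow_self
    have h₂ : 2 * Δ ≤ 2 ^ Δ := by
      cases Δ with
      | zero => simp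
      | succ d => rw [pow_succ, mul_comm]; exact Nat.mul_le_mul_right 2 Nat.lt_two_pow_self
    calc (2 * Δ + 2) * Δ = (Δ + 1) * (2 * Δ) := by ring
      _ ≤ 2 ^ Δ * 2 ^ Δ := Nat.mul_le_mul h₁ h₂
      _ = 4 ^ Δ := (mul_pow 2 2 Δ).symm
  calc (2 * paletteBits Δ j) ^ Δ = (2 ^ (2 * Δ + 1) * tower j) ^ Δ := by
        rw [paletteBits, pow_succ, pow_mul]; ring
    _ ≤ (2 ^ (2 * Δ + 1) * 2 ^ tower (j - 1)) ^ Δ := by gcongr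
    _ = 2 ^ ((2 * Δ + 1 + tower (j - 1)) * Δ) := by rw [← pow_add, ← pow_mul]
    _ ≤ 2 ^ paletteBits Δ (j - 1) := by
      refine Nat.pow_le_pow_right (by norm_num) ?_
      have h₁ := one_le_tower (j - 1)
      calc (2 * Δ + 1 + tower (j - 1)) * Δ ≤ ((2 * Δ + 2) * tower (j - 1)) * Δ := by
            gcongr; nlinarith
        _ = (2 * Δ + 2) * Δ * tower (j - 1) := by ring
        _ ≤ 4 ^ Δ * tower (j - 1) := Nat.mul_le_mul_right _ hΔ

/-- Iterated color reduction on `P[U]` for vertices with `log* = i + 1`, starting from the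
labels. -/
noncomputable def reducedColor (P : SimpleGraph ℕ) (U : Set ℕ) (Δ i : ℕ) : ℕ → ℕ → ℕ
  | 0 => id
  | s + 1 => reduceColor P U Δ (paletteBits Δ (i - s)) (reducedColor P U Δ i s)

/-- The number of colors that remain on `Δ`-bounded graphs after color reduction. It is
irreducible because its values are too large to be evaluated. -/
@[irreducible] def paletteSize (Δ : ℕ) : ℕ := 2 ^ paletteBits Δ 0

theorem isListColoringOn_reducedColor {P : SimpleGraph ℕ} {U : Set ℕ} {Δ i : ℕ}
    (hU : U ⊆ labelClass id (i + 1)) (hdeg : ∀ x ∈ U, {y ∈ U | P.Adj x y}.encard ≤ Δ) (s : ℕ) :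
    IsListColoringOn P U (fun _ => Set.Iio (2 ^ paletteBits Δ (i - s)))
      (reducedColor P U Δ i s) := by
  induction s with
  | zero =>
    refine ⟨fun x hx => ?_, fun x _ y _ hxy => hxy.ne⟩
    have hx : x ≤ tower i := by exact_mod_cast le_tower_of_logStar_le (hU hx).le
    exact (hx.trans (le_paletteBits Δ i)).trans_lt Nat.lt_two_pow_self
  | succ s ih =>
    rw [← Nat.sub_sub]
    exact isListColoringOn_reduceColor hdeg (by positivity) (two_mul_paletteBits_pow_le Δ _) ih

theorem isListColoringOn_reducedColor_self {P : SimpleGraph ℕ} {U : Set ℕ} {Δ i : ℕ}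
    (hU : U ⊆ labelClass id (i + 1)) (hdeg : ∀ x ∈ U, {y ∈ U | P.Adj x y}.encard ≤ Δ) :
    IsListColoringOn P U (fun _ => Set.Iio (paletteSize Δ)) (reducedColor P U Δ i i) := by
  rw [paletteSize, ← Nat.sub_self i]
  exact isListColoringOn_reducedColor hU hdeg i

theorem isLocal_reducedColor {r k Δ i : ℕ} {U : SimpleGraph ℕ → Set ℕ} (hU : IsLocalSet r U)
    (s : ℕ) : IsLocal (r + k * s) fun H => reducedColor (powerGraph H k) (U H) Δ i s := by
  induction s with
  | zero => exact IsLocal.const _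
  | succ s ih =>
    have hmarks := ih.image_powerGraph (IsLocal.mono hU (Nat.le_add_right r _)) k bitMark
    rw [Nat.mul_succ, ← add_assoc]
    exact hmarks.map fun _ => setCode Δ (2 * paletteBits Δ (i - s))

end ColorReduction

section Sweep

variable {V α : Type*}

open Classical in
/-- Greedy recoloring: the color classes of `c` are treated one after the other, and a vertex of
`W` is recolored by applying `f` to the set of the current colors of its neighbors in `P[A]`.
Both maximal independent sets and list colorings are computed in this way. -/
noncomputable def sweep (P : SimpleGraph V) (A W : Set V) (c : V → ℕ) (f : Set α → α)
    (χ₀ : V → α) : ℕ → V → α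
  | 0, x => χ₀ x
  | q + 1, x =>
    if x ∈ W ∧ c x = q then f (sweep P A W c f χ₀ q '' {y ∈ A | P.Adj x y})
    else sweep P A W c f χ₀ q x

variable {P : SimpleGraph V} {A W : Set V} {c : V → ℕ} {f : Set α → α} {χ₀ : V → α}

theorem sweep_of_forall_ne {x : V} {p q : ℕ} (hpq : p ≤ q)
    (h : ∀ n, p ≤ n → n < q → ¬ (x ∈ W ∧ c x = n)) :
    sweep P A W c f χ₀ q x = sweep P A W c f χ₀ p x := by
  induction q, hpq using Nat.le_induction with
  | base => rfl
  | succ q hq ih =>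
    rw [sweep, if_neg (h q hq q.lt_succ_self)]
    exact ih fun n hn hnq => h n hn (hnq.trans q.lt_succ_self)

open Classical in
theorem sweep_of_mem {x : V} {Q : ℕ} (hx : x ∈ W) (hQ : c x < Q) :
    sweep P A W c f χ₀ Q x =
      f ((fun y => if y ∈ W ∧ c x ≤ c y then χ₀ y else sweep P A W c f χ₀ Q y) ''
        {y ∈ A | P.Adj x y}) := by
  rw [sweep_of_forall_ne (p := c x + 1) hQ fun n hn _ h => by omega, sweep, if_pos ⟨hx, rfl⟩]
  refine congrArg f (Set.image_congr fun y _ => ?_)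
  split_ifs with hy
  · exact sweep_of_forall_ne (Nat.zero_le _) fun n _ hn h => by omega
  · exact (sweep_of_forall_ne hQ.le fun n hn _ h => hy ⟨h.1, hn.trans_eq h.2.symm⟩).symm

theorem isLocal_sweep {r k : ℕ} {A W : SimpleGraph ℕ → Set ℕ} {c : SimpleGraph ℕ → ℕ → ℕ}
    {χ₀ : SimpleGraph ℕ → ℕ → α} (hA : IsLocalSet r A) (hW : IsLocalSet r W) (hc : IsLocal r c)
    (hχ₀ : IsLocal r χ₀) (q : ℕ) :
    IsLocal (r + k * q)
      fun H => sweep (powerGraph H k) (A H) (W H) (c H) f (χ₀ H) q := by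
  classical
  induction q with
  | zero => exact hχ₀
  | succ q ih =>
    rw [Nat.mul_succ, ← add_assoc]
    have hturn : IsLocal r fun H a => a ∈ W H ∧ c H a = q := hW.map₂ hc fun _ p m => p ∧ m = q
    have hcolors := ih.image_powerGraph (hA.mono (Nat.le_add_right r (k * q))) k fun _ b => b
    have hkeep := (ih.map₂ (hturn.mono (Nat.le_add_right r (k * q))) fun _ => Prod.mk).mono
      (Nat.le_add_right _ k)
    refine (hcolors.map₂ hkeep fun _ B s => if s.2 then f B else s.1).congr fun H _ a => ?_
    simp only [sweep]

/-- The set of the vertices of `U` that are chosen when the color classes of `c` are treated one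
after the other and a vertex is chosen unless one of its neighbors already is. -/
noncomputable def greedyMIS (P : SimpleGraph V) (U : Set V) (c : V → ℕ) (Q : ℕ) : Set V :=
  {x | sweep P U U c (fun B => True ∉ B) (fun _ => False) Q x}

theorem mem_greedyMIS_iff {U : Set V} {Q : ℕ} (hc : ∀ x ∈ U, c x < Q) {x : V} (hx : x ∈ U) :
    x ∈ greedyMIS P U c Q ↔ ∀ y ∈ U, P.Adj x y → c y < c x → y ∉ greedyMIS P U c Q := by
  classical
  change sweep P U U c _ _ Q x ↔ _
  rw [sweep_of_mem hx (hc x hx)]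
  simp only [Set.mem_image, eq_iff_iff, iff_true, not_exists, not_and, Set.mem_ofPred_eq, and_imp]
  refine forall₃_congr fun y hy _ => ?_
  simp only [hy, true_and, ← not_lt]
  split_ifs with h <;> simp [h, greedyMIS]

theorem isMISOn_greedyMIS {U : Set V} {Q : ℕ}
    (hc : IsListColoringOn P U (fun _ => Set.Iio Q) c) : IsMISOn P U (greedyMIS P U c Q) := by
  have hsub : greedyMIS P U c Q ⊆ U := fun x hx => by
    by_contra hxU
    refine Eq.mp (sweep_of_forall_ne (Nat.zero_le Q) fun _ _ _ h => hxU h.1) hx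
  have hmem {x : V} (hx : x ∈ U) := mem_greedyMIS_iff (P := P) hc.mem_list hx
  refine ⟨hsub, fun x hx y hy hxy => ?_, fun x hx hxM => ?_⟩
  · have hx' := hsub hx
    have hy' := hsub hy
    rcases lt_or_gt_of_ne (hc.proper x hx' y hy' hxy) with h | h
    · exact (hmem hy').mp hy x hx' hxy.symm h hx
    · exact (hmem hx').mp hx y hy' hxy h hy
  · simp only [hmem hx, not_forall, not_not] at hxM
    obtain ⟨y, -, hxy, -, hy⟩ := hxM
    exact ⟨y, hy, hxy⟩

theorem isLocalSet_greedyMIS {r k : ℕ} {U : SimpleGraph ℕ → Set ℕ} {c : SimpleGraph ℕ → ℕ → ℕ}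
    (hU : IsLocalSet r U) (hc : IsLocal r c) (Q : ℕ) :
    IsLocalSet (r + k * Q) fun H => greedyMIS (powerGraph H k) (U H) (c H) Q :=
  isLocal_sweep hU hU hc (IsLocal.const _) Q

variable {C : Type*} [Nonempty C]

/-- A color outside `B`, if there is one. -/
noncomputable def freeColor (B : Set C) : C := Classical.epsilon fun a => a ∉ B

theorem freeColor_image_ne {χ : V → C} {B : Set V} (hB : B.encard < ENat.card C) {y : V}
    (hy : y ∈ B) : freeColor (χ '' B) ≠ χ y := by
  have hex : ∃ a, a ∉ χ '' B := by
    by_contra! h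
    have hcard := Set.encard_image_le χ B
    rw [Set.eq_univ_of_forall h, Set.encard_univ] at hcard
    exact hcard.not_gt hB
  exact fun h => Classical.epsilon_spec hex ⟨y, hy, h.symm⟩

theorem sweep_freeColor_ne {χ₀ : V → C} {Q : ℕ} {x y : V} (hx : x ∈ W) (hy : y ∈ A)
    (hxy : P.Adj x y) (hdeg : {y ∈ A | P.Adj x y}.encard < ENat.card C) (hQ : c x < Q)
    (hlow : ¬ (y ∈ W ∧ c x ≤ c y)) :
    sweep P A W c freeColor χ₀ Q x ≠ sweep P A W c freeColor χ₀ Q y := by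
  classical
  rw [sweep_of_mem hx hQ]
  exact (freeColor_image_ne hdeg ⟨hy, hxy⟩).trans_eq (if_neg hlow)

theorem isListColoringOn_sweep_freeColor {χ₀ : V → C} {Q : ℕ}
    (hWA : W ⊆ A) (hdeg : ∀ x ∈ W, {y ∈ A | P.Adj x y}.encard < ENat.card C)
    (hc : IsListColoringOn P W (fun _ => Set.Iio Q) c) :
    IsListColoringOn P W
      (fun x => {a | ∀ y ∈ A \ W, P.Adj x y → a ≠ sweep P A W c freeColor χ₀ Q y})
      (sweep P A W c freeColor χ₀ Q) := by
  refine ⟨fun x hx y hy hxy => ?_, fun x hx y hy hxy => ?_⟩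
  · exact sweep_freeColor_ne hx hy.1 hxy (hdeg x hx) (hc.mem_list x hx) fun h => hy.2 h.1
  · rcases lt_or_gt_of_ne (hc.proper x hx y hy hxy) with h | h
    · exact (sweep_freeColor_ne hy (hWA hx) hxy.symm (hdeg y hy) (hc.mem_list y hy)
        fun h' => h'.2.not_gt h).symm
    · exact sweep_freeColor_ne hx (hWA hy) hxy (hdeg x hx) (hc.mem_list x hx)
        fun h' => h'.2.not_gt h

end Sweep

section LocalGreedy

variable {r R m : ℕ} {U : Set ℕ} {S : SimpleGraph ℕ → Set ℕ}

theorem IsLocalSet.min_distToSet (hS : IsLocalSet r S) (m : ℕ) :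
    IsLocal (r + m) fun H a => min (distToSet H (S H) a) m := by
  intro H H' hH hH' a ha
  refine eq_of_forall_le_natCast_iff fun n => ?_
  simp only [min_le_iff, distToSet_le_iff, Nat.cast_le]
  rcases le_total m n with h | h
  · simp only [h, or_true]
  · exact or_congr_left (iff_of_eq ((hS.exists_mem_edist_le n).mono (by omega) H H' hH hH' a ha))

theorem IsLocalSet.greedyStep (hS : IsLocalSet r S)
    (hcov : ∀ H, LineMetric H → IsCovering H U (S H) (3 * R - 1)) :
    IsLocalSet (r + 4 * R) fun H => greedyStep H id U R (S H) := by
  let D (H : SimpleGraph ℕ) (a : ℕ) : ℕ∞ := min (distToSet H (S H) a) (3 * R : ℕ)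
  have hDeq {H : SimpleGraph ℕ} (hH : LineMetric H) {a : ℕ} (ha : a ∈ U) :
      D H a = distToSet H (S H) a :=
    min_eq_left ((distToSet_le_iff.mpr (hcov H hH a ha)).trans (by exact_mod_cast Nat.sub_le _ 1))
  have hD : IsLocal (r + 3 * R) D := hS.min_distToSet (3 * R)
  have hbeaten : IsLocal (r + 4 * R) fun H a => ∃ b, H.edist a b ≤ (R - 1 : ℕ) ∧
      b ∈ U ∧ R ≤ D H b ∧ b ≠ a ∧ ¬ (D H b < D H a ∨ D H b = D H a ∧ id b < id a) :=
    (hD.exists_edist_le (R - 1) fun a s b t =>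
      b ∈ U ∧ R ≤ t ∧ b ≠ a ∧ ¬ (t < s ∨ t = s ∧ id b < id a)).mono (by omega)
  have hjoin := ((hD.mono (by omega : r + 3 * R ≤ r + 4 * R)).map₂ hbeaten
    fun a s p => a ∈ U ∧ R ≤ s ∧ ¬ p)
  refine ((hS.mono (Nat.le_add_right r (4 * R))).map₂ hjoin fun _ => Or).congr fun H hH a => ?_
  refine propext (or_congr_right ?_)
  simp only [candidates, Set.mem_ofPred_eq, and_assoc, not_exists, not_and, not_not]
  refine and_congr_right fun ha => ?_
  rw [hDeq hH ha]
  refine and_congr_right fun _ => forall_congr' fun u => ?_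
  by_cases hu : u ∈ U
  · rw [hDeq hH hu]
    exact ⟨fun h hc hne hd => h hd hu hc.2 hne, fun h hd _ hle hne => h ⟨hu, hle⟩ hne hd⟩
  · simp only [hu, false_and, false_imp_iff, imp_true_iff]

theorem IsLocalSet.greedyStep_iterate (hS : IsLocalSet r S)
    (hcov : ∀ H, LineMetric H → IsCovering H U (S H) (3 * R - 1)) (n : ℕ) :
    IsLocalSet (r + 4 * R * n) fun H => (_root_.greedyStep H id U R)^[n] (S H) := by
  induction n with
  | zero => exact hS
  | succ n ih =>
    simp only [Function.iterate_succ_apply', Nat.mul_succ, ← add_assoc]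
    exact ih.greedyStep fun H hH => (hcov H hH).mono (subset_greedyStep_iterate n) le_rfl

end LocalGreedy

section LocalRulingSet

/-- The maximal independent set of `P[U]`, for `U` contained in the class `log* = i + 1`, that is
found greedily from the coloring with `paletteSize Δ` colors. -/
noncomputable def reducedMIS (P : SimpleGraph ℕ) (U : Set ℕ) (Δ i : ℕ) : Set ℕ :=
  greedyMIS P U (reducedColor P U Δ i i) (paletteSize Δ)

theorem isLocalSet_reducedMIS {r k Δ i : ℕ} {U : SimpleGraph ℕ → Set ℕ} (hU : IsLocalSet r U) :
    IsLocalSet (r + k * (i + paletteSize Δ))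
      fun H => reducedMIS (powerGraph H k) (U H) Δ i := by
  rw [mul_add, ← add_assoc]
  exact isLocalSet_greedyMIS (hU.mono (Nat.le_add_right r _)) (isLocal_reducedColor hU i) _

variable {R i : ℕ} {H : SimpleGraph ℕ}

/-- The maximal independent sets of `PathRulingSet` on the class `log* = i + 1`. -/
noncomputable def misChain (R i : ℕ) : ℕ → SimpleGraph ℕ → Set ℕ
  | 0, _ => labelClass id (i + 1)
  | j + 1, H => reducedMIS (powerGraph H (misRadius R (j + 1))) (misChain R i j H) 2 i

theorem isMISChain_misChain (hH : LineMetric H) {j : ℕ} (hj : j ≤ Nat.clog 2 R) :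
    IsMISChain H R j fun l => misChain R i l H := by
  induction j with
  | zero => exact fun l h₁ h₂ => by omega
  | succ j ih =>
    have hchain := ih (Nat.le_of_succ_le hj)
    intro l h₁ h₂
    rcases Nat.le_or_eq_of_le_succ h₂ with hl | rfl
    · exact hchain l h₁ hl
    · exact isMISOn_greedyMIS <| isListColoringOn_reducedColor_self hchain.subset fun x hx =>
        hH.encard_powerGraph_neighbors_le Nat.one_le_two_pow (hchain.isPacking_two_pow hj)
          (misRadius_succ_lt hj) hx

theorem isLocalSet_misChain (R i j : ℕ) :
    IsLocalSet (misRadiusSum R j * (i + paletteSize 2)) (misChain R i j) := by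
  induction j with
  | zero => exact IsLocal.const _
  | succ j ih =>
    rw [misRadiusSum_succ, add_mul]
    exact isLocalSet_reducedMIS ih

/-- The result of `PathRulingSet` on the class `log* = i + 1`. -/
noncomputable def pathSet (R i : ℕ) (H : SimpleGraph ℕ) : Set ℕ :=
  (greedyStep H id (labelClass id (i + 1)) R)^[6] (misChain R i (Nat.clog 2 R) H)

theorem isPathRulingSetResult_pathSet (hH : LineMetric H) :
    IsPathRulingSetResult H id (labelClass id (i + 1)) R (pathSet R i H) :=
  ⟨fun l => misChain R i l H, rfl, isMISChain_misChain hH le_rfl, rfl⟩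

theorem isLocalSet_pathSet (hR : 1 ≤ R) (i : ℕ) :
    IsLocalSet (3 * R * (i + paletteSize 2) + 24 * R) (pathSet R i) := by
  have hlt := misRadiusSum_lt hR
  have hgreedy := IsLocalSet.greedyStep_iterate (R := R) (isLocalSet_misChain R i (Nat.clog 2 R))
    (fun H hH => (isMISChain_misChain hH le_rfl).isCovering.mono subset_rfl
      (Nat.le_sub_one_of_lt hlt)) 6
  refine hgreedy.mono ?_
  have := Nat.mul_le_mul_right (i + paletteSize 2) hlt.le
  omega

/-- The set computed by `ES-ColPathRulingSet` after `V_1, …, V_i` have been treated. -/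
noncomputable def esSet (R : ℕ) : ℕ → SimpleGraph ℕ → Set ℕ
  | 0, _ => ∅
  | i + 1, H => (greedyStep H id (labelClass id (i + 1)) R)^[4]
      (mergeFar H R (esSet R i H) (pathSet R i H))

theorem isSetTrace_esSet (hH : LineMetric H) : IsSetTrace H id R fun i => esSet R i H where
  start := rfl
  extend i := ⟨pathSet R i H, isPathRulingSetResult_pathSet hH, rfl⟩

theorem isLocalSet_esSet (hR : 1 ≤ R) (i : ℕ) :
    IsLocalSet ((41 + 3 * paletteSize 2) * R * i) (esSet R i) := by
  induction i with
  | zero => exact IsLocal.const _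
  | succ i ih =>
    set q := paletteSize 2 with hq
    have hpath : IsLocalSet ((41 + 3 * q) * R * i + (24 + 3 * q) * R) (pathSet R i) :=
      (isLocalSet_pathSet hR i).mono (by rw [← hq]; nlinarith [Nat.zero_le (q * R * i)])
    have hmerge := IsLocalSet.mergeFar (S := esSet R i) (R := R)
      (ih.mono (Nat.le_add_right _ _)) hpath
    have hcov (H) (hH : LineMetric H) := isCovering_mergeFar (S := esSet R i H) hR
      ((isPathRulingSetResult_pathSet hH (i := i)).isLimitedRulingSet hH hR Function.injective_id
        (finite_labelClass Function.injective_id (i + 1))).covering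
    exact (hmerge.greedyStep_iterate hcov 4).mono (by linarith)

end LocalRulingSet

section LocalColoring

variable {R i : ℕ} {H : SimpleGraph ℕ}

/-- The vertices that join while `V_{i+1}` is treated. -/
noncomputable def newSet (R i : ℕ) (H : SimpleGraph ℕ) : Set ℕ := esSet R (i + 1) H \ esSet R i H

/-- The colors that the vertices have after `V_1, …, V_i` have been treated. The new vertices are
recolored one class of `reducedColor` after the other. -/
noncomputable def esColor (R : ℕ) : ℕ → SimpleGraph ℕ → ℕ → Fin 17
  | 0, _ => fun _ => 0
  | i + 1, H =>
    sweep (powerGraph H (9 * R - 1)) (esSet R (i + 1) H) (newSet R i H)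
      (reducedColor (powerGraph H (9 * R - 1)) (newSet R i H) 16 i i) freeColor (esColor R i H)
      (paletteSize 16)

theorem isLocal_esColor (hR : 1 ≤ R) (i : ℕ) :
    IsLocal ((50 + 3 * paletteSize 2 + 9 * paletteSize 16) * R * i) (esColor R i) := by
  induction i with
  | zero => exact IsLocal.const _
  | succ i ih =>
    set q := paletteSize 2
    set Q := paletteSize 16
    have hset := isLocalSet_esSet hR (i + 1)
    have hnew : IsLocalSet ((41 + 3 * q) * R * (i + 1)) (newSet R i) :=
      IsLocalSet.sdiff (S := esSet R (i + 1)) hset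
        ((isLocalSet_esSet hR i).mono (Nat.mul_le_mul_left _ i.le_succ))
    have hcolor := isLocal_reducedColor (k := 9 * R - 1) (Δ := 16) (i := i) hnew i
    have hk (n : ℕ) : (9 * R - 1) * n ≤ 9 * R * n := Nat.mul_le_mul_right n (Nat.sub_le _ 1)
    refine (isLocal_sweep (r := (41 + 3 * q) * R * (i + 1) + 9 * R * i + 9 * Q * R * i)
      (hset.mono ?_) (hnew.mono ?_) (hcolor.mono ?_) (ih.mono ?_) Q).mono ?_
    all_goals linarith [hk i, hk Q, Nat.zero_le (R * i), Nat.zero_le (Q * R * i),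
      Nat.zero_le (q * R)]

theorem newSet_subset_labelClass (hH : LineMetric H) (hR : 1 ≤ R) :
    newSet R i H ⊆ labelClass id (i + 1) := fun _ hx =>
  (isSetTrace_esSet hH).logStar_eq_of_mem_diff hH hR Function.injective_id hx

theorem encard_esSet_neighbors_le (hH : LineMetric H) (hR : 1 ≤ R) {x : ℕ}
    (hx : x ∈ esSet R i H) :
    {y ∈ esSet R i H | (powerGraph H (9 * R - 1)).Adj x y}.encard ≤ (16 : ℕ) :=
  hH.encard_powerGraph_neighbors_le (q := 8) hR
    ((isSetTrace_esSet hH).isLimitedRulingSet hH hR Function.injective_id i).packing (by omega) hx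

theorem isListColoringOn_reducedColor_newSet (hH : LineMetric H) (hR : 1 ≤ R) :
    IsListColoringOn (powerGraph H (9 * R - 1)) (newSet R i H) (fun _ => Set.Iio (paletteSize 16))
      (reducedColor (powerGraph H (9 * R - 1)) (newSet R i H) 16 i i) :=
  isListColoringOn_reducedColor_self (newSet_subset_labelClass hH hR) fun _ hx =>
    (Set.encard_le_encard fun _ => And.imp_left And.left).trans
      (encard_esSet_neighbors_le hH hR hx.1)

theorem esColor_eq_of_le {j : ℕ} (hH : LineMetric H) {x : ℕ} (hx : x ∈ esSet R i H)
    (hij : i ≤ j) : esColor R j H x = esColor R i H x := by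
  induction j, hij using Nat.le_induction with
  | base => rfl
  | succ j hj ih =>
    rw [← ih]
    exact sweep_of_forall_ne (Nat.zero_le _) fun _ _ _ h =>
      h.1.2 ((isSetTrace_esSet hH).mono hj hx)

theorem esColor_logStar (hH : LineMetric H) (hR : 1 ≤ R) {x : ℕ} (hx : x ∈ esSet R i H) :
    esColor R (logStar x) H x = esColor R i H x :=
  have hS := isSetTrace_esSet (R := R) hH
  (esColor_eq_of_le hH (hS.mem_of_mem hH hR Function.injective_id hx)
    ((hS.isLimitedRulingSet hH hR Function.injective_id i).subset hx)).symm

theorem isListColoringOn_esColor (hH : LineMetric H) (hR : 1 ≤ R) :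
    IsListColoringOn (powerGraph H (9 * R - 1)) (newSet R i H)
      (fun u => {c | ∀ w ∈ esSet R i H ∩ neighborhood H (9 * R - 1) {u}, c ≠ esColor R i H w})
      (esColor R (i + 1) H) := by
  have hdeg (x) (hx : x ∈ newSet R i H) :
      {y ∈ esSet R (i + 1) H | (powerGraph H (9 * R - 1)).Adj x y}.encard < ENat.card (Fin 17) := by
    rw [ENat.card_eq_coe_fintype_card, Fintype.card_fin]
    exact (encard_esSet_neighbors_le hH hR hx.1).trans_lt (by norm_num)
  have hsweep := isListColoringOn_sweep_freeColor (χ₀ := esColor R i H) Set.sdiff_subset hdeg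
    (isListColoringOn_reducedColor_newSet hH hR)
  refine ⟨fun u hu w ⟨hw, v, hv, hd⟩ => ?_, hsweep.proper⟩
  obtain rfl : v = u := hv
  have hw' : w ∈ esSet R (i + 1) H \ newSet R i H :=
    ⟨(isSetTrace_esSet hH).mono i.le_succ hw, fun h => h.2 hw⟩
  have hadj : (powerGraph H (9 * R - 1)).Adj v w :=
    ⟨fun h => hu.2 (h ▸ hw), SimpleGraph.edist_comm.trans_le hd⟩
  rw [← esColor_eq_of_le hH hw i.le_succ]
  exact hsweep.mem_list v hu w hw' hadj

theorem isESColTrace_esSet (hH : LineMetric H) (hR : 1 ≤ R) :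
    IsESColTrace H id R (fun i => esSet R i H) fun x => esColor R (logStar x) H x where
  start := rfl
  extend i hi := by
    obtain ⟨j, rfl⟩ := Nat.exists_eq_add_of_le' hi
    exact (isSetTrace_esSet hH).extend j
  color i hi := by
    obtain ⟨j, rfl⟩ := Nat.exists_eq_add_of_le' hi
    have hcol := isListColoringOn_esColor (i := j) hH hR
    refine ⟨fun u hu w hw => ?_, fun u hu v hv huv => ?_⟩
    · rw [esColor_logStar hH hR hu.1, esColor_logStar hH hR hw.1]
      exact hcol.mem_list u hu w hw
    · rw [esColor_logStar hH hR hu.1, esColor_logStar hH hR hv.1]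
      exact hcol.proper u hu v hv huv

end LocalColoring

section Transport

variable {V W : Type*} {G : SimpleGraph V} {f : V ↪ W} {v w : V}

theorem map_adj_apply_left {x : W} : (G.map f).Adj (f v) x ↔ ∃ w, f w = x ∧ G.Adj v w := by
  simp only [SimpleGraph.map_adj, f.injective.eq_iff]
  exact ⟨fun ⟨_, w, h, hv, hw⟩ => ⟨w, hw, hv ▸ h⟩, fun ⟨w, hw, h⟩ => ⟨v, w, h, rfl, hw⟩⟩

theorem edist_map_le_iff {x : W} {n : ℕ} :
    (G.map f).edist (f v) x ≤ n ↔ ∃ w, f w = x ∧ G.edist v w ≤ n := by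
  induction n generalizing v with
  | zero => simp
  | succ n ih =>
    simp only [edist_le_succ_iff, map_adj_apply_left]
    constructor
    · rintro (rfl | ⟨_, ⟨y, rfl, hy⟩, h⟩)
      · exact ⟨v, rfl, Or.inl rfl⟩
      · obtain ⟨w, hw, h⟩ := ih.mp h
        exact ⟨w, hw, Or.inr ⟨y, hy, h⟩⟩
    · rintro ⟨w, rfl, rfl | ⟨y, hy, h⟩⟩
      · exact Or.inl rfl
      · exact Or.inr ⟨f y, ⟨y, rfl, hy⟩, ih.mpr ⟨w, rfl, h⟩⟩

theorem edist_map : (G.map f).edist (f v) (f w) = G.edist v w :=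
  eq_of_forall_le_natCast_iff fun n => by simp [edist_map_le_iff]

theorem exists_eq_of_reachable_map {x : W} (h : (G.map f).Reachable (f v) x) :
    ∃ w, f w = x ∧ G.Reachable v w := by
  obtain ⟨p⟩ := h
  obtain ⟨w, hw, hd⟩ := edist_map_le_iff.mp (edist_le_natCast_iff.mpr ⟨p, le_rfl⟩)
  exact ⟨w, hw, reachable_of_edist_le hd⟩

theorem eq_of_reachable_map_of_notMem_range {a x : W} (ha : a ∉ Set.range f)
    (h : (G.map f).Reachable a x) : a = x := by
  obtain ⟨p⟩ := h
  cases p with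
  | nil => rfl
  | cons hadj _ =>
    obtain ⟨u, _, _, hu, _⟩ := SimpleGraph.map_adj f G _ _ |>.mp hadj
    exact absurd ⟨u, hu⟩ ha

theorem LineMetric.map (hG : LineMetric G) (f : V ↪ W) : LineMetric (G.map f) := by
  intro a
  by_cases ha : a ∈ Set.range f
  · obtain ⟨v, rfl⟩ := ha
    obtain ⟨pos, hpos⟩ := hG v
    have : Nonempty V := ⟨v⟩
    refine ⟨pos ∘ Function.invFun f, fun x y hx hy => ?_⟩
    obtain ⟨u, rfl, hu⟩ := exists_eq_of_reachable_map hx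
    obtain ⟨w, rfl, hw⟩ := exists_eq_of_reachable_map hy
    simp only [Function.comp_apply, Function.leftInverse_invFun f.injective _, edist_map]
    exact hpos u w hu hw
  · refine ⟨fun _ => 0, fun x y hx hy => ?_⟩
    rw [← eq_of_reachable_map_of_notMem_range ha hx, ← eq_of_reachable_map_of_notMem_range ha hy]
    simp

theorem powerGraph_map_adj {k : ℕ} :
    (powerGraph (G.map f) k).Adj (f v) (f w) ↔ (powerGraph G k).Adj v w := by
  simp only [powerGraph, edist_map, f.injective.ne_iff]

theorem exists_mem_edist_map_le_iff {S : Set W} {n : ℕ} :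
    (∃ s ∈ S, (G.map f).edist (f v) s ≤ n) ↔ ∃ s ∈ f ⁻¹' S, G.edist v s ≤ n := by
  constructor
  · rintro ⟨_, hs, hd⟩
    obtain ⟨s, rfl, hd'⟩ := edist_map_le_iff.mp hd
    exact ⟨s, hs, hd'⟩
  · rintro ⟨s, hs, hd⟩
    exact ⟨f s, hs, edist_map.trans_le hd⟩

theorem distToSet_map {S : Set W} : distToSet (G.map f) S (f v) = distToSet G (f ⁻¹' S) v :=
  eq_of_forall_le_natCast_iff fun n => by
    rw [distToSet_le_iff, distToSet_le_iff, exists_mem_edist_map_le_iff]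

theorem preimage_neighborhood_map {k : ℕ} {S : Set W} :
    f ⁻¹' neighborhood (G.map f) k S = neighborhood G k (f ⁻¹' S) :=
  Set.ext fun _ => exists_mem_edist_map_le_iff

variable {R : ℕ} {U S : Set W} {ℓ : W → ℕ}

theorem apply_mem_candidates_map_iff :
    f v ∈ candidates (G.map f) U R S ↔ v ∈ candidates G (f ⁻¹' U) R (f ⁻¹' S) :=
  and_congr_right' (by rw [distToSet_map])

theorem preimage_greedyStep_map :
    f ⁻¹' greedyStep (G.map f) ℓ U R S = greedyStep G (ℓ ∘ f) (f ⁻¹' U) R (f ⁻¹' S) := by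
  ext v
  refine or_congr_right (and_congr apply_mem_candidates_map_iff ⟨fun h u hu huv hd => ?_, ?_⟩)
  · simpa only [distToSet_map, Function.comp_apply] using h (f u)
      (apply_mem_candidates_map_iff.mpr hu) (f.injective.ne huv) (edist_map.trans_le hd)
  · intro h _ hu huv hd
    obtain ⟨u, rfl, hd'⟩ := edist_map_le_iff.mp hd
    simpa only [distToSet_map, Function.comp_apply] using h u (apply_mem_candidates_map_iff.mp hu)
      (fun huv' => huv (congrArg f huv')) hd'

theorem preimage_greedyStep_iterate_map (n : ℕ) :
    f ⁻¹' (greedyStep (G.map f) ℓ U R)^[n] S =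
      (greedyStep G (ℓ ∘ f) (f ⁻¹' U) R)^[n] (f ⁻¹' S) := by
  induction n with
  | zero => rfl
  | succ n ih =>
    rw [Function.iterate_succ_apply', Function.iterate_succ_apply', preimage_greedyStep_map, ih]

theorem IsMISOn.preimage {k : ℕ} (h : IsMISOn (powerGraph (G.map f) k) U S) :
    IsMISOn (powerGraph G k) (f ⁻¹' U) (f ⁻¹' S) where
  subset := Set.preimage_mono h.subset
  independent u hu v hv huv := h.independent (f u) hu (f v) hv (powerGraph_map_adj.mpr huv)
  dominating u hu hu' := by
    obtain ⟨_, hw, huw⟩ := h.dominating (f u) hu hu'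
    obtain ⟨w, rfl, -⟩ := edist_map_le_iff.mp huw.2
    exact ⟨w, hw, powerGraph_map_adj.mp huw⟩

theorem IsPathRulingSetResult.preimage (h : IsPathRulingSetResult (G.map f) ℓ U R S) :
    IsPathRulingSetResult G (ℓ ∘ f) (f ⁻¹' U) R (f ⁻¹' S) := by
  obtain ⟨M, rfl, hM, rfl⟩ := h
  exact ⟨fun j => f ⁻¹' M j, rfl, fun j h₁ h₂ => (hM j h₁ h₂).preimage,
    preimage_greedyStep_iterate_map 6⟩

theorem IsESColTrace.preimage {S : ℕ → Set W} {χ : W → Fin 17}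
    (h : IsESColTrace (G.map f) ℓ R S χ) :
    IsESColTrace G (ℓ ∘ f) R (fun i => f ⁻¹' S i) (χ ∘ f) where
  start := by simp only [h.start, Set.preimage_empty]
  extend i hi := by
    obtain ⟨P, hP, hS⟩ := h.extend i hi
    refine ⟨f ⁻¹' P, hP.preimage, ?_⟩
    rw [hS, preimage_greedyStep_iterate_map, ← preimage_neighborhood_map]
    rfl
  color i hi := by
    have hcol := h.color i hi
    refine ⟨fun u hu w ⟨hw, v, hv, hd⟩ => ?_, fun u hu v hv huv => ?_⟩
    · exact hcol.mem_list (f u) hu (f w) ⟨hw, f v, congrArg f hv, edist_map.trans_le hd⟩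
    · exact hcol.proper (f u) hu (f v) hv (powerGraph_map_adj.mpr huv)

theorem committedOutput_map {χ : W → Fin 17} :
    committedOutput (G.map f) ℓ R S χ (f v) =
      committedOutput G (ℓ ∘ f) R (f ⁻¹' S) (χ ∘ f) v := by
  have hnearby : (committedOutput (G.map f) ℓ R S χ (f v)).nearby =
      (committedOutput G (ℓ ∘ f) R (f ⁻¹' S) (χ ∘ f) v).nearby := by
    ext p
    constructor
    · rintro ⟨_, hu, hd, rfl⟩
      obtain ⟨u, rfl, hd'⟩ := edist_map_le_iff.mp hd
      exact ⟨u, hu, hd', rfl⟩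
    · rintro ⟨u, hu, hd, rfl⟩
      exact ⟨f u, hu, edist_map.trans_le hd, rfl⟩
  exact congrArg (NodeOutput.mk _) hnearby

end Transport

section Simulation

theorem view_zero (H : SimpleGraph ℕ) (a : ℕ) : view H 0 a = ∅ := by
  simp [view]

theorem view_succ (H : SimpleGraph ℕ) (t a : ℕ) :
    view H (t + 1) a =
      view H t a ∪ {p | ∃ b, H.Adj a b ∧ (p = (a, b) ∨ p ∈ view H t b)} := by
  ext ⟨x, y⟩
  simp only [view, Set.mem_union, Set.mem_ofPred_eq, Prod.mk.injEq,
    edist_lt_iff_le_pred t.succ_pos]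
  constructor
  · rintro ⟨hxy, hd⟩
    by_cases hax : a = x
    · exact Or.inr ⟨y, hax ▸ hxy, Or.inl ⟨hax.symm, rfl⟩⟩
    · obtain ⟨t, rfl⟩ : ∃ n, t = n + 1 :=
        Nat.exists_eq_succ_of_ne_zero fun ht => hax (by simpa [ht] using hd)
      obtain ⟨b, hab, hd'⟩ := (edist_le_succ_iff.mp hd).resolve_left hax
      exact Or.inr ⟨b, hab, Or.inr ⟨hxy, (edist_lt_iff_le_pred t.succ_pos).mpr hd'⟩⟩
  · rintro (⟨hxy, hd⟩ | ⟨b, hab, ⟨rfl, rfl⟩ | ⟨hxy, hd⟩⟩)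
    · exact ⟨hxy, hd.le⟩
    · exact ⟨hab, by simp⟩
    · obtain ⟨t, rfl⟩ : ∃ n, t = n + 1 :=
        Nat.exists_eq_succ_of_ne_zero fun ht => by simp [ht] at hd
      exact ⟨hxy, edist_le_succ_iff.mpr
        (Or.inr ⟨b, hab, (edist_lt_iff_le_pred t.succ_pos).mp hd⟩)⟩

/-- The state of a vertex that collects its view: the number of rounds, its label, the labeled
edges that it knows, and its output. -/
structure ViewState (Out : Type) where
  time : ℕ
  label : ℕ
  edges : Set (ℕ × ℕ)
  out : Option Out

variable {Out : Type}

open Classical in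
/-- The output in round `t` of the vertex with label `a` that knows the edges `E`: from round
`ρ a` on, the value of `F` in some labeled line with this view. -/
noncomputable def viewOutput (ρ : ℕ → ℕ) (F : SimpleGraph ℕ → ℕ → Out) (t a : ℕ)
    (E : Set (ℕ × ℕ)) : Option Out :=
  if h : ρ a ≤ t ∧ ∃ H, LineMetric H ∧ view H t a = E then some (F h.2.choose a) else none

/-- The edges known to the vertex with label `a` that knows `E` and receives from each neighbour
its label and the edges known to it. -/
def collectEdges (a : ℕ) (E : Set (ℕ × ℕ)) (m : Multiset (ℕ × Set (ℕ × ℕ))) : Set (ℕ × ℕ) :=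
  E ∪ {p | ∃ msg ∈ m, p = (a, msg.1) ∨ p ∈ msg.2}

/-- The algorithm in which all vertices forward all that they know, and the vertex with label `a`
outputs in round `ρ a` the value of `F` computed from its view. -/
noncomputable def gatherAlgorithm (ρ : ℕ → ℕ) (F : SimpleGraph ℕ → ℕ → Out) :
    LocalAlgorithm Out where
  State := ViewState Out
  Msg := ℕ × Set (ℕ × ℕ)
  init a := ⟨0, a, ∅, viewOutput ρ F 0 a ∅⟩
  send s := (s.label, s.edges)
  step s m :=
    let E := collectEdges s.label s.edges m
    ⟨s.time + 1, s.label, E, s.out.or (viewOutput ρ F (s.time + 1) s.label E)⟩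
  output s := s.out
  commit s m o h := by simp [h]

variable {ρ : ℕ → ℕ} {F : SimpleGraph ℕ → ℕ → Out}

theorem viewOutput_view (hF : IsDeterminedByView ρ F) {H : SimpleGraph ℕ} (hH : LineMetric H)
    (t a : ℕ) :
    viewOutput ρ F t a (view H t a) = if ρ a ≤ t then some (F H a) else none := by
  rw [viewOutput]
  have hexists : ∃ H', LineMetric H' ∧ view H' t a = view H t a := ⟨H, hH, rfl⟩
  split_ifs with h h' h'
  · obtain ⟨hline, hview⟩ := h.2.choose_spec
    exact congrArg some (hF _ H hline hH a (view_eq_of_le hview h'))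
  · exact absurd h.1 h'
  · exact absurd ⟨h', hexists⟩ h
  · rfl

variable {V : Type*} {G : SimpleGraph V} [G.LocallyFinite] {f : V ↪ ℕ}

theorem collectEdges_view (t : ℕ) (v : V) :
    collectEdges (f v) (view (G.map f) t (f v))
        ((G.neighborFinset v).val.map fun u => (f u, view (G.map f) t (f u))) =
      view (G.map f) (t + 1) (f v) := by
  rw [view_succ, collectEdges]
  congr 1
  ext p
  simp only [Set.mem_ofPred_eq, Multiset.mem_map, Finset.mem_val, SimpleGraph.mem_neighborFinset,
    map_adj_apply_left]
  constructor
  · rintro ⟨_, ⟨u, hu, rfl⟩, hp⟩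
    exact ⟨f u, ⟨u, rfl, hu⟩, hp⟩
  · rintro ⟨_, ⟨u, rfl, hu⟩, hp⟩
    exact ⟨_, ⟨u, hu, rfl⟩, hp⟩

theorem state_gatherAlgorithm (hF : IsDeterminedByView ρ F) (hG : LineMetric G) (t : ℕ) (v : V) :
    (gatherAlgorithm ρ F).state G f t v = (⟨t, f v, view (G.map f) t (f v),
      if ρ (f v) ≤ t then some (F (G.map f) (f v)) else none⟩ : ViewState Out) := by
  induction t generalizing v with
  | zero =>
    rw [← viewOutput_view hF (hG.map f), view_zero]
    rfl
  | succ t ih =>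
    have hstep : (gatherAlgorithm ρ F).state G f (t + 1) v =
        (⟨t + 1, f v, view (G.map f) (t + 1) (f v),
          (if ρ (f v) ≤ t then some (F (G.map f) (f v)) else none).or
            (viewOutput ρ F (t + 1) (f v) (view (G.map f) (t + 1) (f v)))⟩ : ViewState Out) := by
      rw [← collectEdges_view, LocalAlgorithm.state]
      simp only [ih]
      rfl
    rw [hstep, viewOutput_view hF (hG.map f)]
    congr 1
    split_ifs <;> first | rfl | omega

theorem run_gatherAlgorithm (hF : IsDeterminedByView ρ F) (hG : LineMetric G) (t : ℕ) (v : V) :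
    (gatherAlgorithm ρ F).run G f t v =
      if ρ (f v) ≤ t then some (F (G.map f) (f v)) else none := by
  rw [LocalAlgorithm.run, state_gatherAlgorithm hF hG]
  rfl

end Simulation

section Output

theorem committedOutput_congr {V : Type*} {G : SimpleGraph V} {ℓ : V → ℕ} {R : ℕ} {S : Set V}
    {χ χ' : V → Fin 17} (h : ∀ u ∈ S, χ u = χ' u) (v : V) :
    committedOutput G ℓ R S χ v = committedOutput G ℓ R S χ' v := by
  unfold committedOutput
  congr 1
  · split_ifs with hv
    · rw [h v hv]
    · rfl
  · ext p
    exact exists_congr fun u => and_congr_right fun hu => by rw [h u hu]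

open Classical in
theorem IsLocal.committedOutput {r R : ℕ} {S : SimpleGraph ℕ → Set ℕ}
    {χ : SimpleGraph ℕ → ℕ → Fin 17} (hS : IsLocalSet r S) (hχ : IsLocal r χ) :
    IsLocal (r + R) fun H a => committedOutput H id R (S H) (χ H) a := by
  have hcolor : IsLocal (r + R) fun H a => if a ∈ S H then some (χ H a) else none :=
    (hS.map₂ hχ fun _ p c => if p then some c else none).mono (Nat.le_add_right r R)
  have hnearby : IsLocal (r + R) fun H a =>
      {p | ∃ u, H.edist a u ≤ ((R - 1 : ℕ) : ℕ∞) ∧ u ∈ S H ∧ p = (u, χ H u)} :=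
    setOf fun p => ((hS.map₂ hχ fun _ => Prod.mk).exists_edist_le (R - 1)
      fun _ _ u d => d.1 ∧ p = (u, d.2)).mono (by omega)
  refine (hcolor.map₂ hnearby fun _ => NodeOutput.mk).congr fun H _ a => ?_
  simp only [_root_.committedOutput, and_left_comm, id]

/-- The output that `ES-ColPathRulingSet(R)` prescribes for the vertex with label `a`. -/
noncomputable def esOutput (R : ℕ) (H : SimpleGraph ℕ) (a : ℕ) : NodeOutput :=
  committedOutput H id R (esSet R (logStar a) H) (fun x => esColor R (logStar x) H x) a

theorem exists_isDeterminedByView_esOutput :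
    ∃ κ, 1 ≤ κ ∧ ∀ R, 1 ≤ R →
      IsDeterminedByView (fun a => κ * R * logStar a) (esOutput R) := by
  set q := paletteSize 2
  set Q := paletteSize 16
  refine ⟨51 + 3 * q + 9 * Q, by omega, fun R hR H H' hH hH' a hview => ?_⟩
  have hlog := one_le_logStar a
  set i := logStar a with hi
  have hset : IsLocalSet ((50 + 3 * q + 9 * Q) * R * i) (esSet R i) :=
    (isLocalSet_esSet hR i).mono (Nat.mul_le_mul_right i (Nat.mul_le_mul_right R (by omega)))
  have hlocal := (IsLocal.committedOutput (R := R) hset (isLocal_esColor hR i)).mono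
    (k := (51 + 3 * q + 9 * Q) * R * i) (by nlinarith)
  unfold esOutput
  rw [← hi, committedOutput_congr (fun x hx => esColor_logStar hH hR hx),
    committedOutput_congr (fun x hx => esColor_logStar hH' hR hx)]
  exact hlocal H H' hH hH' a hview

/-- `ES-ColPathRulingSet(R)` as an algorithm of the LOCAL model, in which the vertices of `V_i`
terminate in round `κ R i`. -/
noncomputable def esAlgorithm (κ R : ℕ) : LocalAlgorithm NodeOutput :=
  gatherAlgorithm (fun a => κ * R * logStar a) (esOutput R)

theorem terminatesInRound_of_eq_ite {V : Type*} {out : ℕ → V → Option NodeOutput} {v : V} {τ : ℕ}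
    {o : NodeOutput} (h : ∀ t, out t v = if τ ≤ t then some o else none) :
    TerminatesInRound out v τ :=
  ⟨by simp [terminatedSet, h], fun t ht => by simp [terminatedSet, h, ht]⟩

variable {V : Type*} {G : SimpleGraph V} [G.LocallyFinite] {f : V ↪ ℕ} {κ R : ℕ}

theorem run_esAlgorithm (hF : IsDeterminedByView (fun a => κ * R * logStar a) (esOutput R))
    (hG : LineMetric G) (t : ℕ) (v : V) :
    (esAlgorithm κ R).run G f t v =
      if κ * R * logStar (f v) ≤ t then some (esOutput R (G.map f) (f v)) else none :=
  run_gatherAlgorithm hF hG t v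

theorem isESColRun_esAlgorithm
    (hF : IsDeterminedByView (fun a => κ * R * logStar a) (esOutput R)) (hG : LineMetric G)
    (hκ : 1 ≤ κ) (hR : 1 ≤ R) :
    IsESColRun G f R (fun i => κ * R * i) ((esAlgorithm κ R).run G f) :=
  ⟨strictMono_mul_left_of_pos (Nat.mul_pos hκ hR), _, _,
    (isESColTrace_esSet (hG.map f) hR).preimage, fun t v =>
      (run_esAlgorithm hF hG t v).trans <|
        if_congr Iff.rfl (congrArg some committedOutput_map) rfl⟩

end Output

theorem mainTheorem4_general :
    (∃ (κ : ℕ) (A : ℕ → LocalAlgorithm NodeOutput) (T : ℕ → ℕ → ℕ),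
      ∀ R : ℕ, 1 ≤ R →
        ∀ (V : Type u) (G : SimpleGraph V) [G.LocallyFinite] (ℓ : V → ℕ),
          LineMetric G → Function.Injective ℓ →
            IsESColRun G ℓ R (T R) ((A R).run G ℓ) ∧
            ∀ v : V, ∃ t ≤ κ * R * logStar (ℓ v),
              TerminatesInRound ((A R).run G ℓ) v t) ∧
    (∀ R : ℕ, 1 ≤ R →
      ∀ (V : Type u) (G : SimpleGraph V) [G.LocallyFinite] (ℓ : V → ℕ),
        LineMetric G → Function.Injective ℓ →
          ∀ (T : ℕ → ℕ) (out : ℕ → V → Option NodeOutput), IsESColRun G ℓ R T out →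
            ∀ t : ℕ, IsCorrectAt G ℓ R out t) := by
  obtain ⟨κ, hκ, hlocal⟩ := exists_isDeterminedByView_esOutput
  refine ⟨⟨κ, esAlgorithm κ, fun R i => κ * R * i, fun R hR V G _ ℓ hG hℓ => ?_⟩,
    fun R hR V G _ ℓ hG hℓ T out h t => h.isCorrectAt hG hR hℓ t⟩
  obtain ⟨f, rfl⟩ : ∃ f : V ↪ ℕ, ⇑f = ℓ := ⟨⟨ℓ, hℓ⟩, rfl⟩
  exact ⟨isESColRun_esAlgorithm (hlocal R hR) hG hκ hR, fun v => ⟨_, le_rfl,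
    terminatesInRound_of_eq_ite fun t => run_esAlgorithm (hlocal R hR) hG t v⟩⟩

theorem mainTheorem4 :
    -- `ES-ColPathRulingSet` has a LOCAL implementation in which `v` terminates within
    -- `κ R log* ℓ(v)` rounds, for a universal constant `κ`
    (∃ (κ : ℕ) (A : ℕ → LocalAlgorithm NodeOutput) (T : ℕ → ℕ → ℕ),
      ∀ R : ℕ, 1 ≤ R →
        ∀ (V : Type u) (G : SimpleGraph V) [G.LocallyFinite] (ℓ : V → ℕ),
          IsInfiniteLine G → IsLabeling ℓ →
            IsESColRun G ℓ R (T R) ((A R).run G ℓ) ∧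
            ∀ v : V, ∃ t ≤ κ * R * logStar (ℓ v),
              TerminatesInRound ((A R).run G ℓ) v t) ∧
    -- every run, whatever maximal independent sets, list colorings and schedule it uses, has
    -- the claimed properties in every round
    (∀ R : ℕ, 1 ≤ R →
      ∀ (V : Type u) (G : SimpleGraph V) [G.LocallyFinite] (ℓ : V → ℕ),
        IsInfiniteLine G → IsLabeling ℓ →
          ∀ (T : ℕ → ℕ) (out : ℕ → V → Option NodeOutput), IsESColRun G ℓ R T out →
            ∀ t : ℕ,
              IsLimitedRulingSet G (terminatedSet out t) (joinedSet out t) R (R - 1) ∧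
              (∃ χ : ((powerGraph G (9 * R - 1)).induce (joinedSet out t)).Coloring (Fin 17),
                ∀ v : joinedSet out t, colorAt out t v = some (χ v)) ∧
              (∀ v : V, TerminatesInRound out v t → ∃ o : NodeOutput, out t v = some o ∧
                ∀ (a : ℕ) (c : Fin 17), (a, c) ∈ o.nearby ↔
                  ∃ u ∈ joinedSet out t, G.edist v u < R ∧ ℓ u = a ∧
                    colorAt out t u = some c)) := by
  obtain ⟨⟨κ, A, T, hA⟩, hrun⟩ := mainTheorem4_general.{u}
  exact ⟨⟨κ, A, T, fun R hR V G _ ℓ hG hℓ => hA R hR V G ℓ hG.lineMetric hℓ.injective⟩,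
    fun R hR V G _ ℓ hG hℓ => hrun R hR V G ℓ hG.lineMetric hℓ.injective⟩
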